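/- Notation. Let $\pi(z_1,z_2)=(z_1+z_2,z_1z_2)$, $\mathbb G_2=\pi(\mathbb D^2)$, $\Gamma=\overline{\mathbb G_2}=\pi(\overline{\mathbb D}^2)$, $b\Gamma=\pi(\mathbb T^2)$, and let $\partial\Gamma$ be the topological boundary of $\Gamma$. A polynomial $q\in\mathbb C[z_1,z_2]$ with zero set $Z(q)$ is $\Gamma$-distinguished if $Z(q)\cap\mathbb G_2\neq\emptyset$ and $Z(q)\cap\partial\Gamma=Z(q)\cap b\Gamma$. A commuting pair $(S,P)$ of bounded operators on a complex Hilbert space is a $\Gamma$-contraction if its Taylor joint spectrum lies in $\Gamma$ and $\|f(S,P)\|\le\sup_\Gamma|f|$ for every rational function $f=p/q$ with $q$ having no zeros in $\Gamma$. A $\Gamma$-contraction is called $\Gamma$-distinguished if it is annihilated by some $\Gamma$-distinguished polynomial. For a contraction $P$ put $D_P=(I-P^*P)^{1/2}$ and $\mathcal D_P=\overline{\operatorname{Ran}}\,D_P$. A fundamental operator of $(S,P)$ is an operator $A\in\mathcal B(\mathcal D_P)$ with $S-S^*P=D_PAD_P$. Theorem. Let $(S,P)$ be a $\Gamma$-distinguished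 $\Gamma$-contraction on a complex Hilbert space $\mathcal H$ with $\dim\mathcal D_P<\infty$. Then $(S,P)$ has exactly one fundamental operator $A$. Let $T_A,V_0$ be the operators on $\mathcal H\oplus\ell^2(\mathcal D_P)$ given by $$T_A(x_0,x_1,x_2,\dots)=(Sx_0,\;A^*D_Px_0+Ax_1,\;A^*x_1+Ax_2,\;\dots),\qquad V_0(x_0,x_1,x_2,\dots)=(Px_0,\;D_Px_0,\;x_1,\;x_2,\dots)$$ (the minimal $\Gamma$-isometric dilation of $(S,P)$). The following are equivalent: (1) $(T_A,V_0)$ is $\Gamma$-distinguished (on $\mathcal H\oplus\ell^2(\mathcal D_P)$); (2) $(A,0)$ is $\Gamma$-distinguished (on $\mathcal D_P$); (3) the spectral radius of $A$ satisfies $r(A)<1$. -/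

import Mathlib

open scoped ENNReal InnerProductSpace

noncomputable section

namespace SymBidisc

/-! ### The symmetrized bidisc and distinguished polynomials -/

/-- The symmetrization map `π(z₁, z₂) = (z₁ + z₂, z₁ z₂)`. -/
def symmetrize (z : ℂ × ℂ) : ℂ × ℂ := (z.1 + z.2, z.1 * z.2)

/-- The open symmetrized bidisc `𝔾₂ = π(𝔻²)`. -/
def openSymBidisc : Set (ℂ × ℂ) := symmetrize '' {z | ‖z.1‖ < 1 ∧ ‖z.2‖ < 1}

/-- The closed symmetrized bidisc `Γ = π(closed bidisc)`. -/
def Gamma : Set (ℂ × ℂ) := symmetrize '' {z | ‖z.1‖ ≤ 1 ∧ ‖z.2‖ ≤ 1}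

/-- The distinguished boundary `bΓ = π(𝕋²)`. -/
def bGamma : Set (ℂ × ℂ) := symmetrize '' {z | ‖z.1‖ = 1 ∧ ‖z.2‖ = 1}

/-- The value of a polynomial in two variables at a point of `ℂ²`. -/
def polyEval (q : MvPolynomial (Fin 2) ℂ) (z : ℂ × ℂ) : ℂ :=
  MvPolynomial.eval ![z.1, z.2] q

/-- The zero set `Z(q) ⊆ ℂ²`. -/
def zeroSet (q : MvPolynomial (Fin 2) ℂ) : Set (ℂ × ℂ) := {z | polyEval q z = 0}

/-- `q` is `Γ`-distinguished: `Z(q)` meets `𝔾₂`, and `Z(q) ∩ ∂Γ = Z(q) ∩ bΓ`, where `∂Γ` is the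
topological boundary. -/
def IsGammaDistinguishedPoly (q : MvPolynomial (Fin 2) ℂ) : Prop :=
  (zeroSet q ∩ openSymBidisc).Nonempty ∧
    zeroSet q ∩ frontier Gamma = zeroSet q ∩ bGamma

/-! ### Pairs of operators -/

section Pairs

variable {H : Type*} [NormedAddCommGroup H] [InnerProductSpace ℂ H]

/-- The operator `q(S, P)`, for a polynomial `q` and a commuting pair `(S, P)`. -/
def opEval (q : MvPolynomial (Fin 2) ℂ) (S P : H →L[ℂ] H) : H →L[ℂ] H :=
  ∑ m ∈ q.support, q.coeff m • (S ^ m 0 * P ^ m 1)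

/-- Exactness of the Koszul complex
`0 → H → H ⊕ H → H → 0`, `x ↦ (S x, P x)`, `(x, y) ↦ S y - P x`. -/
def KoszulExact (S P : H →L[ℂ] H) : Prop :=
  (∀ x, S x = 0 → P x = 0 → x = 0) ∧
    (∀ x y, S y - P x = 0 → ∃ w, S w = x ∧ P w = y) ∧
    (∀ z, ∃ x y, S y - P x = z)

/-- The Taylor joint spectrum of a commuting pair `(S, P)`. -/
def taylorSpectrum (S P : H →L[ℂ] H) : Set (ℂ × ℂ) :=
  {l | ¬ KoszulExact (S - l.1 • (1 : H →L[ℂ] H)) (P - l.2 • (1 : H →L[ℂ] H))}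

/-- `(S, P)` is a `Γ`-contraction: `S` and `P` commute and `Γ` is a spectral set for `(S, P)`, that
is, the Taylor joint spectrum lies in `Γ` and, for every rational function `f = p / q` with `q`
without zeros in `Γ`, the operator `f(S, P) = p(S, P) q(S, P)⁻¹` makes sense and satisfies von
Neumann's inequality `‖f(S, P)‖ ≤ sup_Γ |f|`. -/
structure IsGammaContraction (S P : H →L[ℂ] H) : Prop where
  commute : Commute S P
  taylorSpectrum_subset : taylorSpectrum S P ⊆ Gamma
  isUnit_opEval : ∀ q : MvPolynomial (Fin 2) ℂ, (∀ z ∈ Gamma, polyEval q z ≠ 0) →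
    IsUnit (opEval q S P)
  vonNeumann : ∀ p q : MvPolynomial (Fin 2) ℂ, (∀ z ∈ Gamma, polyEval q z ≠ 0) →
    ‖opEval p S P * Ring.inverse (opEval q S P)‖ ≤
      sSup ((fun z => ‖polyEval p z / polyEval q z‖) '' Gamma)

/-- `(S, P)` is `Γ`-distinguished: it is a `Γ`-contraction annihilated by some `Γ`-distinguished
polynomial. -/
def IsGammaDistinguished (S P : H →L[ℂ] H) : Prop :=
  IsGammaContraction S P ∧
    ∃ q : MvPolynomial (Fin 2) ℂ, IsGammaDistinguishedPoly q ∧ opEval q S P = 0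

end Pairs

/-! ### Defect operator and fundamental operator -/

section Defect

variable {H : Type*} [NormedAddCommGroup H] [InnerProductSpace ℂ H] [CompleteSpace H]

/-- The defect operator `D_P = (I - P* P)^{1/2}` of a contraction `P` (positive square root). -/
def defectOp (P : H →L[ℂ] H) : H →L[ℂ] H := CFC.sqrt (1 - star P * P)

/-- The defect space `𝒟_P`, the closure of the range of `D_P`. -/
def defectSpace (P : H →L[ℂ] H) : Submodule ℂ H :=
  (LinearMap.range (defectOp P : H →ₗ[ℂ] H)).topologicalClosure

instance (P : H →L[ℂ] H) : CompleteSpace (defectSpace P) :=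
  (Submodule.isClosed_topologicalClosure _).completeSpace_coe

/-- `D_P` as an operator from `H` into `𝒟_P`. -/
def defectMap (P : H →L[ℂ] H) : H →L[ℂ] defectSpace P :=
  (defectOp P).codRestrict (defectSpace P)
    fun x => Submodule.le_topologicalClosure _ ⟨x, rfl⟩

/-- `A ∈ B(𝒟_P)` solves the fundamental equation `S - S* P = D_P A D_P`. -/
def IsFundamentalOperator (S P : H →L[ℂ] H) (A : defectSpace P →L[ℂ] defectSpace P) : Prop :=
  S - star S * P = defectOp P ∘L (defectSpace P).subtypeL ∘L A ∘L defectMap P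

end Defect

/-! ### The dilation `(T_A, V₀)` on `H ⊕ ℓ²(𝒟_P)` -/

section Ell2

variable {E : Type*} [NormedAddCommGroup E]

/-- The space `ℓ²(E)` of square summable sequences in `E`. -/
abbrev Ell2 (E : Type*) [NormedAddCommGroup E] : Type _ := lp (fun _ : ℕ => E) 2

/-- The sequence `(0, x₁, x₂, …)`. -/
def shiftFun (x : ℕ → E) : ℕ → E
  | 0 => 0
  | n + 1 => x n

theorem hasSum_shiftFun (x : Ell2 E) :
    HasSum (fun n => ‖shiftFun (x : ℕ → E) n‖ ^ (2 : ℝ≥0∞).toReal)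
      (‖x‖ ^ (2 : ℝ≥0∞).toReal) := by
  have h := lp.hasSum_norm (p := 2) (by norm_num) x
  have h2 : HasSum (fun n => ‖shiftFun (x : ℕ → E) (n + 1)‖ ^ (2 : ℝ≥0∞).toReal)
      (‖x‖ ^ (2 : ℝ≥0∞).toReal) := h
  have h3 := (hasSum_nat_add_iff
    (f := fun n => ‖shiftFun (x : ℕ → E) n‖ ^ (2 : ℝ≥0∞).toReal) 1).1 h2
  simpa [shiftFun] using h3

variable [NormedSpace ℂ E]

/-- The diagonal operator `(x₁, x₂, …) ↦ (A x₁, A x₂, …)` on `ℓ²(E)`. -/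
def diagOp (A : E →L[ℂ] E) : Ell2 E →L[ℂ] Ell2 E :=
  lp.mapCLM 2 (fun _ => A) (norm_nonneg A) (fun _ => le_rfl)

/-- The right shift `(x₁, x₂, …) ↦ (0, x₁, x₂, …)` on `ℓ²(E)`. -/
def shiftOp : Ell2 E →L[ℂ] Ell2 E :=
  LinearMap.mkContinuous
    { toFun := fun x => ⟨shiftFun x, memℓp_gen (hasSum_shiftFun x).summable⟩
      map_add' := fun x y => by
        ext n
        cases n
        · exact (add_zero (0 : E)).symm
        · rfl
      map_smul' := fun c x => by
        ext n
        cases n <;> simp [shiftFun] }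
    1
    fun x => by
      have h := lp.hasSum_norm (p := 2) (by norm_num)
        (⟨shiftFun x, memℓp_gen (hasSum_shiftFun x).summable⟩ : Ell2 E)
      have h2 := h.unique (hasSum_shiftFun x)
      have h3 := (Real.rpow_left_inj (norm_nonneg _) (norm_nonneg _) (by norm_num)).1 h2
      simpa using h3.le

/-- The embedding `x ↦ (x, 0, 0, …)` of `E` into `ℓ²(E)`. -/
def firstOp : E →L[ℂ] Ell2 E := lp.singleContinuousLinearMap ℂ (fun _ : ℕ => E) 2 0

end Ell2

section Dilation

variable {H : Type*} [NormedAddCommGroup H] [InnerProductSpace ℂ H]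

/-- The operator with block matrix `[[T, 0], [C, D]]` on the Hilbert space direct sum `H ⊕ L`. -/
def lowerBlock {L : Type*} [NormedAddCommGroup L] [InnerProductSpace ℂ L]
    (T : H →L[ℂ] H) (C : H →L[ℂ] L) (D : L →L[ℂ] L) :
    WithLp 2 (H × L) →L[ℂ] WithLp 2 (H × L) :=
  (WithLp.prodContinuousLinearEquiv 2 ℂ H L).symm.toContinuousLinearMap ∘L
    (T ∘L WithLp.fstL 2 ℂ H L).prod (C ∘L WithLp.fstL 2 ℂ H L + D ∘L WithLp.sndL 2 ℂ H L)

variable [CompleteSpace H]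

/-- The Hilbert space `H ⊕ ℓ²(𝒟_P)`. -/
abbrev DilationSpace (P : H →L[ℂ] H) : Type _ := WithLp 2 (H × Ell2 (defectSpace P))

/-- `T_A (x₀, x₁, x₂, …) = (S x₀, A* D_P x₀ + A x₁, A* x₁ + A x₂, A* x₂ + A x₃, …)`. -/
def dilationT (S P : H →L[ℂ] H) (A : defectSpace P →L[ℂ] defectSpace P) :
    DilationSpace P →L[ℂ] DilationSpace P :=
  lowerBlock S (firstOp ∘L star A ∘L defectMap P) (diagOp A + shiftOp ∘L diagOp (star A))

/-- `V₀ (x₀, x₁, x₂, …) = (P x₀, D_P x₀, x₁, x₂, …)`. -/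
def dilationV (P : H →L[ℂ] H) : DilationSpace P →L[ℂ] DilationSpace P :=
  lowerBlock P (firstOp ∘L defectMap P) shiftOp

theorem dilationT_fst (S P : H →L[ℂ] H) (A : defectSpace P →L[ℂ] defectSpace P)
    (x : DilationSpace P) : (dilationT S P A x).fst = S x.fst := rfl

theorem dilationT_snd_zero (S P : H →L[ℂ] H) (A : defectSpace P →L[ℂ] defectSpace P)
    (x : DilationSpace P) :
    (dilationT S P A x).snd 0 = star A (defectMap P x.fst) + A (x.snd 0) := by
  change lp.single (E := fun _ : ℕ => defectSpace P) 2 0 (star A (defectMap P x.fst)) 0 +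
    (A (x.snd 0) + 0) = _
  simp

theorem dilationT_snd_succ (S P : H →L[ℂ] H) (A : defectSpace P →L[ℂ] defectSpace P)
    (x : DilationSpace P) (n : ℕ) :
    (dilationT S P A x).snd (n + 1) = star A (x.snd n) + A (x.snd (n + 1)) := by
  change lp.single (E := fun _ : ℕ => defectSpace P) 2 0 (star A (defectMap P x.fst)) (n + 1) +
    (A (x.snd (n + 1)) + star A (x.snd n)) = _
  simp [add_comm]

theorem dilationV_fst (P : H →L[ℂ] H) (x : DilationSpace P) :
    (dilationV P x).fst = P x.fst := rfl

theorem dilationV_snd_zero (P : H →L[ℂ] H) (x : DilationSpace P) :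
    (dilationV P x).snd 0 = defectMap P x.fst := by
  change lp.single (E := fun _ : ℕ => defectSpace P) 2 0 (defectMap P x.fst) 0 + 0 = _
  simp

theorem dilationV_snd_succ (P : H →L[ℂ] H) (x : DilationSpace P) (n : ℕ) :
    (dilationV P x).snd (n + 1) = x.snd n := by
  change lp.single (E := fun _ : ℕ => defectSpace P) 2 0 (defectMap P x.fst) (n + 1) +
    x.snd n = _
  simp

end Dilation

end SymBidisc

end

/-!
For `a` in the closed unit disc and `|p| ≤ 1` the point `(a + p ā, p)` lies in `Γ`; it lies in `𝔾₂`
when `|a|, |p| < 1` and in `bΓ` when `|p| = 1`. The points of `Γ` coming from `A` have this form, with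
`a` a value `⟪x, A x⟫ / ‖x‖²` of the numerical range of the fundamental operator `A`.

**Fundamental operator.** Von Neumann's inequality for `(2 β p - s) / (2 t - β s)`, with `|β| = 1`
and `t` decreasing to `1`, gives `|⟪x, (S - S* P) x⟫| ≤ ‖D_P x‖²`. So the form of `S - S* P` factors
through `D_P`, which yields `A` and shows that its numerical radius is at most one
(`IsGammaContraction.exists_isFundamentalOperator`, `IsFundamentalOperator.norm_inner_le`).

**`Γ`-isometries.** Let `V` be an isometry commuting with `T = T* V`. For each polynomial
`X = p(T, V)` the operator `X' = X* Vᴺ` commutes with `T` and `V` for large `N`, and `‖X' y‖ = ‖X y‖`. This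
gives `|⟪Q y, P w⟫| ≤ ‖P y‖ ‖Q w‖` for polynomials `P, Q` in `(T, V)`, so every rational function
`F` of `(T, V)` satisfies `‖F²‖ = ‖F‖²` and its norm is its spectral radius. Hence `(T, V)` is a
`Γ`-contraction as soon as its joint spectrum lies in `Γ` (`isGammaContraction_of_isometry`), and no
unitary extension is needed. The joint spectrum is handled through the characters of the
bicommutant, a commutative Banach algebra (`exists_joint_spectrum_point`).

**The polynomial `det (A + p A* - s)`.** By Cayley–Hamilton it annihilates the pair
`(A + M_z A*, M_z)` on `ℓ²(𝒟_P)` (`opHom_pencilPoly`). Its zeros with `|p| ≤ 1` are points `(a + p ā, p)`, so this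
pair has joint spectrum in `Γ`. If `|a| = 1` and `|p| < 1` then `a` is an eigenvalue of `A`, by
extremality in the numerical range; so when `r(A) < 1` all zeros in `∂Γ` lie in `bΓ`
(`isGammaDistinguishedPoly_pencilPoly`).

**The equivalence.** `(T_A, V₀)` is block triangular with diagonal `(S, P)` and `(A + M_z A*, M_z)`,
which puts its spectrum in `Γ`. If `r(A) < 1`, the product of `s det (A + p A* - s)` with a
distinguished polynomial annihilating `(S, P)` annihilates it. Conversely, `(A, 0)` is the
compression of `(A + M_z A*, M_z)` to the quotient by the range of `M_z`, so it inherits the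
annihilating polynomial; and an eigenvalue `c` of `A` with `|c| = 1` would give that polynomial the
zero `(c, 0)` in `∂Γ` outside `bΓ`.
-/

noncomputable section

namespace SymBidisc

/-! ### Polynomial calculus for a commuting pair -/

section Calculus

variable {H : Type*} [NormedAddCommGroup H] [InnerProductSpace ℂ H]

/-- The bicommutant of `{S, P}`; it is closed and contains the inverses of its units. -/
def bicomm (S P : H →L[ℂ] H) : Subalgebra ℂ (H →L[ℂ] H) :=
  Subalgebra.centralizer ℂ (Set.centralizer {S, P})

theorem mem_bicomm_left (S P : H →L[ℂ] H) : S ∈ bicomm S P :=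
  Set.subset_centralizer_centralizer (Set.mem_insert S {P})

theorem mem_bicomm_right (S P : H →L[ℂ] H) : P ∈ bicomm S P :=
  Set.subset_centralizer_centralizer (Set.mem_insert_of_mem S rfl)

theorem bicomm_mul_comm {S P : H →L[ℂ] H} (h : Commute S P) (a b : bicomm S P) :
    a * b = b * a := by
  have hsub : ({S, P} : Set (H →L[ℂ] H)) ⊆ Set.centralizer {S, P} := by
    rintro x (rfl | rfl) y (rfl | rfl)
    exacts [rfl, h.symm.eq, h.eq, rfl]
  exact Subtype.ext ((a.2 b (Set.centralizer_subset hsub b.2)).symm)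

/-- For a commuting pair the bicommutant is a commutative normed ring. -/
abbrev bicommNormedCommRing {S P : H →L[ℂ] H} (h : Commute S P) : NormedCommRing (bicomm S P) :=
  { (inferInstance : NormedRing (bicomm S P)) with mul_comm := bicomm_mul_comm h }

/-- The polynomial calculus `q ↦ q(S, P)` of a commuting pair, as a homomorphism into the
bicommutant. -/
def bicommHom {S P : H →L[ℂ] H} (h : Commute S P) :
    MvPolynomial (Fin 2) ℂ →ₐ[ℂ] bicomm S P :=
  letI := bicommNormedCommRing h
  MvPolynomial.aeval ![⟨S, mem_bicomm_left S P⟩, ⟨P, mem_bicomm_right S P⟩]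

/-- The polynomial calculus `q ↦ q(S, P)` of a commuting pair of operators. -/
def opHom {S P : H →L[ℂ] H} (h : Commute S P) : MvPolynomial (Fin 2) ℂ →ₐ[ℂ] (H →L[ℂ] H) :=
  (bicomm S P).val.comp (bicommHom h)

@[simp] theorem opHom_X_zero {S P : H →L[ℂ] H} (h : Commute S P) :
    opHom h (MvPolynomial.X 0) = S := by
  simp [opHom, bicommHom]

@[simp] theorem opHom_X_one {S P : H →L[ℂ] H} (h : Commute S P) :
    opHom h (MvPolynomial.X 1) = P := by
  simp [opHom, bicommHom]

@[simp] theorem opHom_C {S P : H →L[ℂ] H} (h : Commute S P) (c : ℂ) :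
    opHom h (MvPolynomial.C c) = c • (1 : H →L[ℂ] H) := by
  rw [← MvPolynomial.algebraMap_eq, AlgHom.commutes, Algebra.algebraMap_eq_smul_one]

theorem opEval_eq {S P : H →L[ℂ] H} (h : Commute S P) (q : MvPolynomial (Fin 2) ℂ) :
    opEval q S P = opHom h q := by
  conv_rhs => rw [q.as_sum]
  rw [map_sum]
  refine Finset.sum_congr rfl fun m _ => ?_
  rw [MvPolynomial.monomial_eq, Finsupp.prod_fintype _ _ (fun _ => pow_zero _),
    Fin.prod_univ_two]
  simp [Algebra.algebraMap_eq_smul_one]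

@[simp] theorem polyEval_X_zero (z : ℂ × ℂ) : polyEval (MvPolynomial.X 0) z = z.1 := by
  simp [polyEval]

@[simp] theorem polyEval_X_one (z : ℂ × ℂ) : polyEval (MvPolynomial.X 1) z = z.2 := by
  simp [polyEval]

@[simp] theorem polyEval_C (c : ℂ) (z : ℂ × ℂ) : polyEval (MvPolynomial.C c) z = c := by
  simp [polyEval]

@[simp] theorem polyEval_one (z : ℂ × ℂ) : polyEval 1 z = 1 := by
  simp [polyEval]

@[simp] theorem polyEval_mul (p q : MvPolynomial (Fin 2) ℂ) (z : ℂ × ℂ) :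
    polyEval (p * q) z = polyEval p z * polyEval q z := by
  simp [polyEval]

@[simp] theorem polyEval_add (p q : MvPolynomial (Fin 2) ℂ) (z : ℂ × ℂ) :
    polyEval (p + q) z = polyEval p z + polyEval q z := by
  simp [polyEval]

@[simp] theorem polyEval_sub (p q : MvPolynomial (Fin 2) ℂ) (z : ℂ × ℂ) :
    polyEval (p - q) z = polyEval p z - polyEval q z := by
  simp [polyEval]

/-- Characters of the bicommutant provide a point `l` of the joint spectrum at which a given
polynomial with non-invertible `q(S, P)` vanishes; joint spectrum is meant here in the weak sense
that `r(S, P)` is not invertible whenever `r(l) = 0`. -/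
theorem exists_joint_spectrum_point [CompleteSpace H] {S P : H →L[ℂ] H} (h : Commute S P)
    {q : MvPolynomial (Fin 2) ℂ} (hq : ¬ IsUnit (opHom h q)) :
    ∃ l : ℂ × ℂ, polyEval q l = 0 ∧ ∀ r, polyEval r l = 0 → ¬ IsUnit (opHom h r) := by
  let := bicommNormedCommRing h
  have : CompleteSpace (bicomm S P) := by
    have hc : IsClosed (bicomm S P : Set (H →L[ℂ] H)) := Set.isClosed_centralizer _
    exact hc.completeSpace_coe
  have hq' : ¬ IsUnit (bicommHom h q) := fun hu => hq (hu.map (bicomm S P).val)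
  let : NormedAlgebra ℂ (bicomm S P) := Subalgebra.toNormedAlgebra _
  obtain ⟨f, hf⟩ := WeakDual.CharacterSpace.exists_apply_eq_zero hq'
  have key : ∀ r, f (bicommHom h r) = polyEval r (f ⟨S, mem_bicomm_left S P⟩,
      f ⟨P, mem_bicomm_right S P⟩) := by
    intro r
    induction r using MvPolynomial.induction_on with
    | C a =>
      rw [← MvPolynomial.algebraMap_eq, AlgHom.commutes, AlgHomClass.commutes,
        MvPolynomial.algebraMap_eq, polyEval_C]
      rfl
    | add p q hp hq => simp only [map_add, polyEval_add, hp, hq]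
    | mul_X p n hp =>
      rw [map_mul, map_mul, hp, polyEval_mul]
      congr 1
      fin_cases n <;> simp [polyEval, bicommHom]
  refine ⟨_, (key q).symm.trans hf, fun r hr hu => ?_⟩
  obtain ⟨u, hu⟩ := hu
  -- the inverse of an element of the bicommutant lies in the bicommutant
  have hv : (↑u⁻¹ : H →L[ℂ] H) ∈ bicomm S P := by
    intro x hx
    have hc : Commute x (u : H →L[ℂ] H) := by
      rw [hu]
      exact (bicommHom h r).2 x hx
    exact (hc.units_inv_right).eq
  have h1 : bicommHom h r * ⟨_, hv⟩ = 1 := Subtype.ext (by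
    change opHom h r * (↑u⁻¹ : H →L[ℂ] H) = 1
    rw [← hu, Units.mul_inv])
  have h2 := congrArg f h1
  rw [map_mul, key, hr, zero_mul, map_one] at h2
  exact zero_ne_one h2

variable {K : Type*} [NormedAddCommGroup K] [InnerProductSpace ℂ K]

theorem opHom_intertwine {S P : H →L[ℂ] H} {T V : K →L[ℂ] K} (h : Commute S P) (h' : Commute T V)
    {R : H →L[ℂ] K} (hS : R ∘L S = T ∘L R) (hP : R ∘L P = V ∘L R)
    (q : MvPolynomial (Fin 2) ℂ) : R ∘L opHom h q = opHom h' q ∘L R := by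
  induction q using MvPolynomial.induction_on with
  | C a => ext x; simp
  | add p q hp hq => simp only [map_add, ContinuousLinearMap.comp_add,
      ContinuousLinearMap.add_comp, hp, hq]
  | mul_X p n hp =>
    have hn : R ∘L opHom h (MvPolynomial.X n) = opHom h' (MvPolynomial.X n) ∘L R := by
      fin_cases n
      · simpa using hS
      · simpa using hP
    rw [map_mul, map_mul, ContinuousLinearMap.mul_def, ContinuousLinearMap.mul_def,
      ← ContinuousLinearMap.comp_assoc, hp, ContinuousLinearMap.comp_assoc, hn,
      ContinuousLinearMap.comp_assoc]

theorem commute_opHom {S P G : H →L[ℂ] H} (h : Commute S P) (hS : Commute G S) (hP : Commute G P)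
    (q : MvPolynomial (Fin 2) ℂ) : Commute G (opHom h q) :=
  opHom_intertwine h h hS.eq hP.eq q

theorem commute_opHom_opHom {S P : H →L[ℂ] H} (h : Commute S P)
    (p q : MvPolynomial (Fin 2) ℂ) : Commute (opHom h p) (opHom h q) :=
  (Commute.all p q).map (opHom h)

end Calculus

/-! ### Geometry of the symmetrized bidisc -/

section Geometry

open ComplexConjugate

theorem exists_add_mul_eq (s p : ℂ) : ∃ z w : ℂ, z + w = s ∧ z * w = p := by
  obtain ⟨z, hz⟩ := IsAlgClosed.exists_pow_nat_eq (s ^ 2 - 4 * p) (n := 2) (by norm_num)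
  refine ⟨(s + z) / 2, (s - z) / 2, by ring, ?_⟩
  linear_combination (-1 / 4) * hz

theorem isCompact_Gamma : IsCompact Gamma := by
  have h : {z : ℂ × ℂ | ‖z.1‖ ≤ 1 ∧ ‖z.2‖ ≤ 1}
      = Metric.closedBall 0 1 ×ˢ Metric.closedBall 0 1 := by
    ext z; simp
  unfold Gamma
  rw [h]
  refine ((isCompact_closedBall _ _).prod (isCompact_closedBall _ _)).image ?_
  unfold symmetrize
  fun_prop

theorem root_of_mem_Gamma {l : ℂ × ℂ} (hl : l ∈ Gamma) {z : ℂ} (hz : z ^ 2 - z * l.1 + l.2 = 0) :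
    ‖z‖ ≤ 1 := by
  obtain ⟨x, ⟨h1, h2⟩, rfl⟩ := hl
  have h3 : (z - x.1) * (z - x.2) = 0 := by
    simp only [symmetrize] at hz
    linear_combination hz
  rcases mul_eq_zero.1 h3 with h | h
  · rwa [sub_eq_zero.1 h]
  · rwa [sub_eq_zero.1 h]

theorem mem_Gamma_of_roots {l : ℂ × ℂ} (h : ∀ z : ℂ, z ^ 2 - z * l.1 + l.2 = 0 → ‖z‖ ≤ 1) :
    l ∈ Gamma := by
  obtain ⟨z, w, h1, h2⟩ := exists_add_mul_eq l.1 l.2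
  refine ⟨(z, w), ⟨h z ?_, h w ?_⟩, Prod.ext h1 h2⟩
  · rw [← h1, ← h2]; ring
  · rw [← h1, ← h2]; ring

theorem mem_openSymBidisc_of_roots {l : ℂ × ℂ}
    (h : ∀ z : ℂ, z ^ 2 - z * l.1 + l.2 = 0 → ‖z‖ < 1) : l ∈ openSymBidisc := by
  obtain ⟨z, w, h1, h2⟩ := exists_add_mul_eq l.1 l.2
  refine ⟨(z, w), ⟨h z ?_, h w ?_⟩, Prod.ext h1 h2⟩
  · rw [← h1, ← h2]; ring
  · rw [← h1, ← h2]; ring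

theorem norm_snd_le_of_mem_Gamma {l : ℂ × ℂ} (hl : l ∈ Gamma) : ‖l.2‖ ≤ 1 := by
  obtain ⟨x, ⟨h1, h2⟩, rfl⟩ := hl
  simpa [symmetrize] using mul_le_one₀ h1 (norm_nonneg _) h2

theorem norm_fst_le_of_mem_Gamma {l : ℂ × ℂ} (hl : l ∈ Gamma) : ‖l.1‖ ≤ 2 := by
  obtain ⟨x, ⟨h1, h2⟩, rfl⟩ := hl
  exact (norm_add_le x.1 x.2).trans (by linarith)

theorem norm_snd_of_mem_bGamma {l : ℂ × ℂ} (hl : l ∈ bGamma) : ‖l.2‖ = 1 := by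
  obtain ⟨x, ⟨h1, h2⟩, rfl⟩ := hl
  simp [symmetrize, h1, h2]

/-- `|z - a|² - |1 - ā z|² = (|z|² - 1)(1 - |a|²)`. -/
theorem norm_sq_sub_norm_sq (z a : ℂ) :
    ‖z - a‖ ^ 2 - ‖1 - conj a * z‖ ^ 2 = (‖z‖ ^ 2 - 1) * (1 - ‖a‖ ^ 2) := by
  simp only [← Complex.normSq_eq_norm_sq, Complex.normSq_apply]
  simp
  ring

/-- The roots of `z² - (a + p ā) z + p` satisfy `z (z - a) = p (ā z - 1)`. -/
theorem norm_root_eq {a p z : ℂ} (hz : z ^ 2 - z * (a + p * conj a) + p = 0) :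
    ‖z‖ * ‖z - a‖ = ‖p‖ * ‖1 - conj a * z‖ := by
  rw [← norm_mul, ← norm_mul, ← norm_neg (p * _)]
  congr 1
  linear_combination hz

theorem add_mul_conj_mem_Gamma {a p : ℂ} (ha : ‖a‖ ≤ 1) (hp : ‖p‖ ≤ 1) :
    (a + p * conj a, p) ∈ Gamma := by
  refine mem_Gamma_of_roots fun z hz => ?_
  by_contra! hz1
  have h1 := norm_root_eq hz
  have h2 := norm_sq_sub_norm_sq z a
  have h3 : 0 ≤ (‖z‖ ^ 2 - 1) * (1 - ‖a‖ ^ 2) :=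
    mul_nonneg (by nlinarith) (by nlinarith [norm_nonneg a])
  have h4 : ‖1 - conj a * z‖ ≤ ‖z - a‖ := abs_le_of_sq_le_sq' (by linarith) (norm_nonneg _) |>.2
  have h5 : 0 < ‖z - a‖ := by
    rw [norm_pos_iff, sub_ne_zero]
    rintro rfl
    linarith
  have h6 : ‖p‖ * ‖1 - conj a * z‖ ≤ 1 * ‖z - a‖ := by gcongr
  nlinarith

theorem add_mul_conj_mem_openSymBidisc {a p : ℂ} (ha : ‖a‖ < 1) (hp : ‖p‖ < 1) :
    (a + p * conj a, p) ∈ openSymBidisc := by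
  refine mem_openSymBidisc_of_roots fun z hz => ?_
  by_contra! hz1
  have h1 := norm_root_eq hz
  have h2 := norm_sq_sub_norm_sq z a
  have h3 : 0 ≤ (‖z‖ ^ 2 - 1) * (1 - ‖a‖ ^ 2) :=
    mul_nonneg (by nlinarith) (by nlinarith [norm_nonneg a])
  have h4 : ‖1 - conj a * z‖ ≤ ‖z - a‖ := abs_le_of_sq_le_sq' (by linarith) (norm_nonneg _) |>.2
  have h5 : 0 < ‖z - a‖ := by
    rw [norm_pos_iff, sub_ne_zero]
    rintro rfl
    linarith
  have h6 : ‖p‖ * ‖1 - conj a * z‖ ≤ ‖p‖ * ‖z - a‖ := by gcongr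
  nlinarith

theorem add_mul_conj_mem_bGamma {a p : ℂ} (ha : ‖a‖ ≤ 1) (hp : ‖p‖ = 1) :
    (a + p * conj a, p) ∈ bGamma := by
  obtain ⟨x, ⟨h1, h2⟩, h3⟩ := add_mul_conj_mem_Gamma ha hp.le
  have h4 : ‖x.1‖ * ‖x.2‖ = 1 := by
    rw [← norm_mul, ← hp]
    exact congrArg (fun l : ℂ × ℂ => ‖l.2‖) h3
  have := norm_nonneg x.1
  have := norm_nonneg x.2
  exact ⟨x, ⟨by nlinarith, by nlinarith⟩, h3⟩

/-- `𝔾₂` is the set `|s - s̄ p| < 1 - |p|²`; membership is witnessed by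
`a = (s - s̄ p) / (1 - |p|²)`, for which `s = a + p ā`. -/
theorem openSymBidisc_eq :
    openSymBidisc = {l : ℂ × ℂ | ‖l.1 - conj l.1 * l.2‖ < 1 - ‖l.2‖ ^ 2} := by
  ext ⟨s, p⟩
  constructor
  · rintro ⟨⟨z, w⟩, ⟨hz, hw⟩, h⟩
    simp only [symmetrize, Prod.mk.injEq] at h hz hw
    obtain ⟨rfl, rfl⟩ := h
    simp only [Set.mem_ofPred_eq]
    have h1 : z + w - conj (z + w) * (z * w)
        = z * ((1 - ‖w‖ ^ 2 : ℝ) : ℂ) + w * ((1 - ‖z‖ ^ 2 : ℝ) : ℂ) := by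
      push_cast
      rw [← Complex.conj_mul', ← Complex.conj_mul', map_add]
      ring
    have hz0 := norm_nonneg z
    have hw0 := norm_nonneg w
    rw [h1, norm_mul]
    refine (norm_add_le _ _).trans_lt ?_
    rw [norm_mul, norm_mul, Complex.norm_real, Complex.norm_real,
      Real.norm_of_nonneg (by nlinarith), Real.norm_of_nonneg (by nlinarith)]
    have h2 : 0 < (1 - ‖z‖) * (1 - ‖w‖) * (1 - ‖z‖ * ‖w‖) :=
      mul_pos (mul_pos (by linarith) (by linarith)) (by nlinarith)
    nlinarith
  · intro h
    simp only [Set.mem_ofPred_eq] at h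
    have hp0 := norm_nonneg p
    have h0 : 0 < 1 - ‖p‖ ^ 2 := (norm_nonneg _).trans_lt h
    have h0' : (1 - p * conj p : ℂ) ≠ 0 := by
      rw [Complex.mul_conj']
      exact_mod_cast h0.ne'
    have hconj : conj (1 - p * conj p) = 1 - p * conj p := by
      simp [mul_comm]
    have hn : ‖1 - p * conj p‖ = 1 - ‖p‖ ^ 2 := by
      rw [Complex.mul_conj']
      rw [show (1 - (‖p‖ : ℂ) ^ 2) = ((1 - ‖p‖ ^ 2 : ℝ) : ℂ) by push_cast; rfl, Complex.norm_real,
        Real.norm_of_nonneg h0.le]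
    set a : ℂ := (s - conj s * p) / (1 - p * conj p) with ha
    have ha1 : ‖a‖ < 1 := by
      rw [ha, norm_div, hn, div_lt_one h0]
      exact h
    have hs : s = a + p * conj a := by
      rw [ha, map_div₀, hconj, map_sub, map_mul, Complex.conj_conj]
      field_simp
      ring
    rw [hs]
    exact add_mul_conj_mem_openSymBidisc ha1 (by nlinarith)

theorem isOpen_openSymBidisc : IsOpen openSymBidisc := by
  rw [openSymBidisc_eq]
  exact isOpen_lt (by fun_prop) (by fun_prop)

theorem openSymBidisc_subset_Gamma : openSymBidisc ⊆ Gamma :=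
  Set.image_mono fun _ h => ⟨h.1.le, h.2.le⟩

theorem bGamma_subset_Gamma : bGamma ⊆ Gamma :=
  Set.image_mono fun _ h => ⟨h.1.le, h.2.le⟩

theorem frontier_subset_Gamma : frontier Gamma ⊆ Gamma :=
  isCompact_Gamma.isClosed.frontier_subset

theorem notMem_openSymBidisc_of_mem_frontier {l : ℂ × ℂ} (hl : l ∈ frontier Gamma) :
    l ∉ openSymBidisc := fun h =>
  hl.2 (interior_maximal openSymBidisc_subset_Gamma isOpen_openSymBidisc h)

/-- A point of `Γ` all of whose multiples `(t s, t² p)` with `t > 1` leave `Γ` is a boundary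
point. -/
theorem mem_frontier_of_forall_notMem {l : ℂ × ℂ} (hl : l ∈ Gamma)
    (h : ∀ t : ℝ, 1 < t → ((t : ℂ) * l.1, (t : ℂ) ^ 2 * l.2) ∉ Gamma) : l ∈ frontier Gamma := by
  refine ⟨subset_closure hl, fun hi => ?_⟩
  have hc : ContinuousAt (fun t : ℝ => ((t : ℂ) * l.1, (t : ℂ) ^ 2 * l.2)) 1 := by fun_prop
  have h1 : ∀ᶠ t : ℝ in nhds 1, ((t : ℂ) * l.1, (t : ℂ) ^ 2 * l.2) ∈ Gamma := by
    refine hc.eventually_mem ?_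
    simpa using mem_interior_iff_mem_nhds.1 hi
  have h2 : ∀ᶠ t : ℝ in nhdsWithin 1 (Set.Ioi 1), False := by
    filter_upwards [h1.filter_mono nhdsWithin_le_nhds, self_mem_nhdsWithin] with t ht1 ht2
    exact h t ht2 ht1
  exact h2.exists.elim fun _ h => h

theorem bGamma_subset_frontier : bGamma ⊆ frontier Gamma := fun l hl => by
  refine mem_frontier_of_forall_notMem (bGamma_subset_Gamma hl) fun t ht hmem => ?_
  have h1 := norm_snd_le_of_mem_Gamma hmem
  simp only [norm_mul, norm_pow, Complex.norm_real, norm_snd_of_mem_bGamma hl] at h1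
  rw [Real.norm_of_nonneg (by linarith)] at h1
  nlinarith

theorem norm_le_one_of_mem_Gamma {c : ℂ} (h : (c, (0 : ℂ)) ∈ Gamma) : ‖c‖ ≤ 1 :=
  root_of_mem_Gamma h (by simp; ring)

theorem mem_frontier_of_norm_eq_one {c : ℂ} (hc : ‖c‖ = 1) : (c, (0 : ℂ)) ∈ frontier Gamma := by
  refine mem_frontier_of_forall_notMem ?_ fun t ht hmem => ?_
  · simpa using add_mul_conj_mem_Gamma (a := c) (p := 0) hc.le (by simp)
  · simp only [mul_zero] at hmem
    have h1 := norm_le_one_of_mem_Gamma hmem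
    rw [norm_mul, hc, Complex.norm_real, Real.norm_of_nonneg (by linarith)] at h1
    linarith

theorem isGammaDistinguishedPoly_iff {q : MvPolynomial (Fin 2) ℂ} :
    IsGammaDistinguishedPoly q ↔ (∃ l ∈ openSymBidisc, polyEval q l = 0) ∧
      ∀ l ∈ frontier Gamma, polyEval q l = 0 → l ∈ bGamma := by
  constructor
  · rintro ⟨⟨l, h1, h2⟩, h3⟩
    exact ⟨⟨l, h2, h1⟩, fun l hl hq => (h3.subset ⟨hq, hl⟩).2⟩
  · rintro ⟨⟨l, h1, h2⟩, h3⟩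
    exact ⟨⟨l, h2, h1⟩, Set.Subset.antisymm (fun l hl => ⟨hl.1, h3 l hl.2 hl.1⟩)
      fun l hl => ⟨hl.1, bGamma_subset_frontier hl.2⟩⟩

theorem IsGammaDistinguishedPoly.mul {p q : MvPolynomial (Fin 2) ℂ}
    (hp : IsGammaDistinguishedPoly p) (hq : IsGammaDistinguishedPoly q) :
    IsGammaDistinguishedPoly (p * q) := by
  rw [isGammaDistinguishedPoly_iff] at *
  obtain ⟨⟨l, hl, h0⟩, h1⟩ := hp
  refine ⟨⟨l, hl, by simp [h0]⟩, fun m hm h => ?_⟩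
  rw [polyEval_mul, mul_eq_zero] at h
  exact h.elim (h1 m hm) (hq.2 m hm)

end Geometry

/-! ### Spectral inclusion in `Γ` -/

section Spectral

variable {H : Type*} [NormedAddCommGroup H] [InnerProductSpace ℂ H]

theorem polyEval_div_le_sSup {p q : MvPolynomial (Fin 2) ℂ} (hq : ∀ z ∈ Gamma, polyEval q z ≠ 0)
    {l : ℂ × ℂ} (hl : l ∈ Gamma) :
    ‖polyEval p l / polyEval q l‖ ≤ sSup ((fun z => ‖polyEval p z / polyEval q z‖) '' Gamma) := by
  have hc : ∀ r : MvPolynomial (Fin 2) ℂ, Continuous fun z : ℂ × ℂ => polyEval r z := fun r => by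
    refine r.continuous_eval.comp ?_
    refine continuous_pi fun i => ?_
    fin_cases i
    · exact continuous_fst
    · exact continuous_snd
  refine le_csSup (isCompact_Gamma.image_of_continuousOn ?_).bddAbove ⟨l, hl, rfl⟩
  exact (((hc p).continuousOn).div (hc q).continuousOn hq).norm

/-- The polynomial `z² - z s + p`, whose zero set for `|z| > 1` misses `Γ`. -/
def rootPoly (z : ℂ) : MvPolynomial (Fin 2) ℂ :=
  MvPolynomial.C (z ^ 2) - MvPolynomial.C z * MvPolynomial.X 0 + MvPolynomial.X 1

@[simp] theorem polyEval_rootPoly (z : ℂ) (l : ℂ × ℂ) :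
    polyEval (rootPoly z) l = z ^ 2 - z * l.1 + l.2 := by
  simp only [rootPoly, polyEval_add, polyEval_sub, polyEval_mul, polyEval_C, polyEval_X_zero,
    polyEval_X_one]

theorem rootPoly_ne_zero {z : ℂ} (hz : 1 < ‖z‖) : ∀ l ∈ Gamma, polyEval (rootPoly z) l ≠ 0 :=
  fun l hl h => by
    rw [polyEval_rootPoly] at h
    exact (root_of_mem_Gamma hl h).not_gt hz

/-- The joint spectrum of `(S, P)` lies in `Γ`, in the form that every point outside `Γ` is
separated from it by one of the polynomials `z² - z s + p` with `|z| > 1`. -/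
def SpectrumInGamma {S P : H →L[ℂ] H} (h : Commute S P) : Prop :=
  ∀ z : ℂ, 1 < ‖z‖ → IsUnit (opHom h (rootPoly z))

theorem IsGammaContraction.spectrumInGamma {S P : H →L[ℂ] H} (h : IsGammaContraction S P) :
    SpectrumInGamma h.commute := fun z hz => by
  rw [← opEval_eq]
  exact h.isUnit_opEval _ (rootPoly_ne_zero hz)

theorem SpectrumInGamma.taylorSpectrum_subset {S P : H →L[ℂ] H} {h : Commute S P}
    (hG : SpectrumInGamma h) : taylorSpectrum S P ⊆ Gamma := by
  intro l hl
  refine mem_Gamma_of_roots fun z hz => ?_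
  by_contra! hz1
  refine hl ?_
  obtain ⟨u, hu⟩ := hG z hz1
  set Y : H →L[ℂ] H := ↑u⁻¹ with hY
  set S' := S - l.1 • (1 : H →L[ℂ] H) with hS'
  set P' := P - l.2 • (1 : H →L[ℂ] H) with hP'
  -- the polynomial vanishes at `l`, so it is a combination of `s - l₁` and `p - l₂`
  have hu' : (u : H →L[ℂ] H) = P' - z • S' := by
    rw [hu, rootPoly, map_add, map_sub, map_mul, opHom_C, opHom_C, opHom_X_zero, opHom_X_one,
      hS', hP']
    have : (z ^ 2 : ℂ) = z * l.1 - l.2 := by linear_combination hz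
    rw [this, smul_sub, sub_smul, mul_smul, smul_mul_assoc, one_mul]
    abel
  have hSu : Commute S' (u : H →L[ℂ] H) := by
    rw [hu]
    refine commute_opHom h ?_ ?_ _
    · exact (Commute.refl S).sub_left ((Commute.one_left S).smul_left _)
    · exact h.sub_left ((Commute.one_left P).smul_left _)
  have hPu : Commute P' (u : H →L[ℂ] H) := by
    rw [hu]
    refine commute_opHom h ?_ ?_ _
    · exact h.symm.sub_left ((Commute.one_left S).smul_left _)
    · exact (Commute.refl P).sub_left ((Commute.one_left P).smul_left _)
  have hSY : ∀ x, S' (Y x) = Y (S' x) := fun x =>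
    congrArg (fun B : H →L[ℂ] H => B x) hSu.units_inv_right.eq
  have hPY : ∀ x, P' (Y x) = Y (P' x) := fun x =>
    congrArg (fun B : H →L[ℂ] H => B x) hPu.units_inv_right.eq
  have hYu : ∀ x, Y (P' x) - z • Y (S' x) = x := fun x => by
    have h1 := congrArg (fun B : H →L[ℂ] H => B x) u.inv_mul
    simp only [hu'] at h1
    simpa using h1
  refine ⟨fun x hx hy => ?_, fun x y hxy => ?_, fun w => ?_⟩
  · rw [← hYu x, hx, hy]; simp
  · have hxy' : S' y = P' x := sub_eq_zero.1 hxy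
    refine ⟨Y (y - z • x), ?_, ?_⟩
    · rw [hSY, map_sub, map_smul, hxy', map_sub, map_smul, hYu]
    · have hc : P' (S' y) = S' (P' y) := by
        have h1 : Commute P' S' :=
          ((h.symm.sub_right ((Commute.one_right P).smul_right _)).sub_left
            ((Commute.one_left _).smul_left _))
        exact congrArg (fun B : H →L[ℂ] H => B y) h1.eq
      rw [hPY, map_sub, map_smul, ← hxy', map_sub, map_smul, hYu]
  · refine ⟨-Y w, -(z • Y w), ?_⟩
    rw [map_neg, map_neg, map_smul, hSY, hPY]
    nth_rw 3 [← hYu w]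
    abel

theorem SpectrumInGamma.exists_mem_Gamma [CompleteSpace H] {S P : H →L[ℂ] H} {h : Commute S P}
    (hG : SpectrumInGamma h) {q : MvPolynomial (Fin 2) ℂ} (hq : ¬ IsUnit (opHom h q)) :
    ∃ l ∈ Gamma, polyEval q l = 0 := by
  obtain ⟨l, hl, hr⟩ := exists_joint_spectrum_point h hq
  refine ⟨l, mem_Gamma_of_roots fun z hz => ?_, hl⟩
  by_contra! hz1
  exact hr (rootPoly z) (by simpa using hz) (hG z hz1)

theorem SpectrumInGamma.isUnit [CompleteSpace H] {S P : H →L[ℂ] H} {h : Commute S P}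
    (hG : SpectrumInGamma h) {q : MvPolynomial (Fin 2) ℂ} (hq : ∀ z ∈ Gamma, polyEval q z ≠ 0) :
    IsUnit (opHom h q) := by
  by_contra hu
  obtain ⟨l, hl, h0⟩ := hG.exists_mem_Gamma hu
  exact hq l hl h0

/-- `p(S, P) q(S, P)⁻¹ - μ = (p - μ q)(S, P) q(S, P)⁻¹` is invertible unless `p - μ q` has a zero
in `Γ`. -/
theorem SpectrumInGamma.spectralRadius_le [CompleteSpace H] {S P : H →L[ℂ] H} {h : Commute S P}
    (hG : SpectrumInGamma h) (p : MvPolynomial (Fin 2) ℂ) {q : MvPolynomial (Fin 2) ℂ}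
    (hq : ∀ z ∈ Gamma, polyEval q z ≠ 0) :
    spectralRadius ℂ (opHom h p * Ring.inverse (opHom h q)) ≤
      ENNReal.ofReal (sSup ((fun z => ‖polyEval p z / polyEval q z‖) '' Gamma)) := by
  refine iSup₂_le fun μ hμ => ?_
  have hu := hG.isUnit hq
  have h1 : ¬ IsUnit (opHom h (MvPolynomial.C μ * q - p)) := fun h2 => by
    refine (spectrum.mem_iff.1 hμ) ?_
    have h3 : algebraMap ℂ (H →L[ℂ] H) μ - opHom h p * Ring.inverse (opHom h q)
        = opHom h (MvPolynomial.C μ * q - p) * Ring.inverse (opHom h q) := by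
      rw [map_sub, map_mul, sub_mul, mul_assoc, Ring.mul_inverse_cancel _ hu, mul_one, opHom_C,
        Algebra.algebraMap_eq_smul_one]
    rw [h3]
    exact h2.mul hu.ringInverse
  obtain ⟨l, hl, h0⟩ := hG.exists_mem_Gamma h1
  rw [polyEval_sub, polyEval_mul, polyEval_C, sub_eq_zero] at h0
  have h2 : μ = polyEval p l / polyEval q l := by
    rw [← h0, mul_div_cancel_right₀ _ (hq l hl)]
  have h3 := polyEval_div_le_sSup (p := p) hq hl
  rw [← h2] at h3
  rw [← enorm_eq_nnnorm, ← ofReal_norm]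
  exact ENNReal.ofReal_le_ofReal h3

end Spectral

/-! ### Von Neumann's inequality for `Γ`-isometries -/

section Isometry

variable {H : Type*} [NormedAddCommGroup H] [InnerProductSpace ℂ H] [CompleteSpace H]

/-- For a `Γ`-isometry and a polynomial `p`, the operator `p(T, V)* Vᴺ` is again a polynomial in
`T` and `V` for large `N`; only its commutation with `T` and `V` is recorded.
The generators have `T* V = T` and `V* V = 1`, and `(X Y)* Vᴺ⁺ᴹ = (Y* Vᴹ) (X* Vᴺ)`. -/
theorem exists_commute_star_mul_pow {T V : H →L[ℂ] H} (h : Commute T V) (hV : star V * V = 1)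
    (hT : star T * V = T) (p : MvPolynomial (Fin 2) ℂ) :
    ∃ N, ∀ k, Commute (star (opHom h p) * V ^ (N + k)) T ∧
      Commute (star (opHom h p) * V ^ (N + k)) V := by
  have hmono : ∀ {X : H →L[ℂ] H} {N : ℕ}, Commute (star X * V ^ N) T ∧ Commute (star X * V ^ N) V →
      ∀ k, Commute (star X * V ^ (N + k)) T ∧ Commute (star X * V ^ (N + k)) V := by
    intro X N hX k
    rw [pow_add, ← mul_assoc]
    exact ⟨hX.1.mul_left (h.symm.pow_left k), hX.2.mul_left ((Commute.refl V).pow_left k)⟩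
  induction p using MvPolynomial.induction_on with
  | C a =>
    refine ⟨0, fun k => hmono ?_ k⟩
    rw [opHom_C, star_smul, star_one, pow_zero, mul_one]
    exact ⟨(Commute.one_left T).smul_left _, (Commute.one_left V).smul_left _⟩
  | add p q hp hq =>
    obtain ⟨N, hN⟩ := hp
    obtain ⟨M, hM⟩ := hq
    refine ⟨N + M, fun k => ?_⟩
    rw [map_add, star_add, add_mul]
    have h1 := hN (M + k)
    have h2 := hM (N + k)
    rw [← add_assoc] at h1 h2
    rw [add_comm M N] at h2
    exact ⟨h1.1.add_left h2.1, h1.2.add_left h2.2⟩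
  | mul_X p n hp =>
    obtain ⟨N, hN⟩ := hp
    refine ⟨N + 1, fun k => hmono ?_ k⟩
    have hN0 := hN 0
    rw [add_zero] at hN0
    have hn : Commute (star (opHom h (MvPolynomial.X n)) * V) T ∧
        Commute (star (opHom h (MvPolynomial.X n)) * V) V := by
      fin_cases n
      · simp [hT, h]
      · simp [hV]
    have h1 : star (opHom h (p * MvPolynomial.X n)) * V ^ (N + 1)
        = (star (opHom h (MvPolynomial.X n)) * V) * (star (opHom h p) * V ^ N) := by
      rw [map_mul, star_mul, pow_succ]
      simp only [mul_assoc]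
      rw [← mul_assoc (star (opHom h p)), hN0.2.eq]
    rw [h1]
    exact ⟨hn.1.mul_left hN0.1, hn.2.mul_left hN0.2⟩

theorem star_pow_mul_pow {V : H →L[ℂ] H} (hV : star V * V = 1) (N : ℕ) :
    star V ^ N * V ^ N = 1 := by
  induction N with
  | zero => simp
  | succ n ih => rw [pow_succ, pow_succ', mul_assoc, ← mul_assoc (star V), hV, one_mul, ih]

/-- Joint hyponormality of the polynomials in a `Γ`-isometry: with `X' = X* Vᴺ` one has
`⟪Q y, P w⟫ = ⟪P' y, Q' w⟫` and `‖P' y‖ = ‖P y‖`, `‖Q' w‖ = ‖Q w‖`. -/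
theorem norm_inner_opHom_le {T V : H →L[ℂ] H} (h : Commute T V) (hV : star V * V = 1)
    (hT : star T * V = T) (p q : MvPolynomial (Fin 2) ℂ) (y w : H) :
    ‖⟪opHom h q y, opHom h p w⟫_ℂ‖ ≤ ‖opHom h p y‖ * ‖opHom h q w‖ := by
  obtain ⟨N, hN⟩ := exists_commute_star_mul_pow h hV hT p
  obtain ⟨M, hM⟩ := exists_commute_star_mul_pow h hV hT q
  have hN' := hN M
  have hM' := hM N
  rw [add_comm M N] at hM'
  set n := N + M
  have hVn := star_pow_mul_pow hV n
  have hstar : ∀ r, star (opHom h r) = star V ^ n * (star (opHom h r) * V ^ n) := fun r => by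
    have h1 : Commute (star (opHom h r)) (star V ^ n) := by
      have h2 : Commute V (opHom h r) := commute_opHom h h.symm (Commute.refl V) r
      exact (h2.star_star.pow_left n).symm
    rw [← mul_assoc, ← h1.eq, mul_assoc, hVn, mul_one]
  have hnorm : ∀ r, Commute (star (opHom h r) * V ^ n) T ∧ Commute (star (opHom h r) * V ^ n) V →
      ∀ x, ‖(star (opHom h r) * V ^ n) x‖ = ‖opHom h r x‖ := fun r hr x => by
    have h1 : star (star (opHom h r) * V ^ n) * (star (opHom h r) * V ^ n)
        = star (opHom h r) * opHom h r := by
      rw [star_mul, star_star, star_pow, mul_assoc, ← (commute_opHom h hr.1 hr.2 r).eq, ← mul_assoc,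
        ← hstar]
    have h2 : ∀ B : H →L[ℂ] H, ‖B x‖ ^ 2 = RCLike.re ⟪x, (star B * B) x⟫_ℂ := fun B => by
      rw [ContinuousLinearMap.star_eq_adjoint]
      exact ContinuousLinearMap.apply_norm_sq_eq_inner_adjoint_right B x
    have h3 : ‖(star (opHom h r) * V ^ n) x‖ ^ 2 = ‖opHom h r x‖ ^ 2 := by rw [h2, h2, h1]
    exact (pow_left_inj₀ (norm_nonneg _) (norm_nonneg _) two_ne_zero).1 h3
  rw [← hnorm p hN', ← hnorm q hM']
  have hadj : ∀ (B : H →L[ℂ] H) (x z : H), ⟪x, B z⟫_ℂ = ⟪star B x, z⟫_ℂ := fun B x z => by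
    rw [ContinuousLinearMap.star_eq_adjoint, ContinuousLinearMap.adjoint_inner_left]
  have h1 : ⟪opHom h q y, opHom h p w⟫_ℂ
      = ⟪(star (opHom h p) * V ^ n) y, (star (opHom h q) * V ^ n) w⟫_ℂ := by
    have h2 := congrArg (fun B : H →L[ℂ] H => B y) (commute_opHom h hN'.1 hN'.2 q).eq
    have h3 : star (opHom h p) (opHom h q y)
        = (star V ^ n) (opHom h q ((star (opHom h p) * V ^ n) y)) := by
      have h4 := congrArg (fun B : H →L[ℂ] H => B (opHom h q y)) (hstar p)
      simp only [mul_apply_eq_comp] at h2 h4 ⊢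
      rw [h4, h2]
    rw [hadj, h3, hadj, star_mul, star_star, star_pow]
    rfl
  rw [h1]
  exact norm_inner_le_norm _ _

/-- Rational functions of a `Γ`-isometry are paranormal, hence satisfy `‖F‖² ≤ ‖F²‖`. -/
theorem norm_sq_le_of_isometry {T V : H →L[ℂ] H} (h : Commute T V) (hV : star V * V = 1)
    (hT : star T * V = T) (p : MvPolynomial (Fin 2) ℂ) {q : MvPolynomial (Fin 2) ℂ}
    (hq : IsUnit (opHom h q)) :
    ‖opHom h p * Ring.inverse (opHom h q)‖ ^ 2
      ≤ ‖(opHom h p * Ring.inverse (opHom h q)) ^ 2‖ := by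
  set R := Ring.inverse (opHom h q) with hR
  have hQR : opHom h q * R = 1 := Ring.mul_inverse_cancel _ hq
  have hPR : Commute (opHom h p) R := by
    obtain ⟨u, hu⟩ := hq
    rw [hR, ← hu, Ring.inverse_unit]
    refine Commute.units_inv_right ?_
    rw [hu]
    exact commute_opHom_opHom h p q
  have hap : ∀ {A B : H →L[ℂ] H}, A = B → ∀ x, A x = B x := fun hAB x => by rw [hAB]
  rw [← Real.sqrt_le_sqrt_iff (norm_nonneg _), Real.sqrt_sq (norm_nonneg _)]
  refine ContinuousLinearMap.opNorm_le_bound _ (Real.sqrt_nonneg _) fun x => ?_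
  -- the inequality `‖Q P y‖² ≤ ‖P² y‖ ‖Q² y‖` at `y = Q⁻² x`
  have h1 := norm_inner_opHom_le h hV hT p q (opHom h p (R (R x))) (opHom h q (R (R x)))
  have e1 : opHom h q (opHom h p (R (R x))) = (opHom h p * R) x := by
    refine hap (?_ : opHom h q * (opHom h p * (R * R)) = opHom h p * R) x
    rw [← mul_assoc, (commute_opHom_opHom h q p).eq, mul_assoc, ← mul_assoc _ R, hQR, one_mul]
  have e2 : opHom h p (opHom h q (R (R x))) = (opHom h p * R) x := by
    refine hap (?_ : opHom h p * (opHom h q * (R * R)) = opHom h p * R) x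
    rw [← mul_assoc _ R, hQR, one_mul]
  have e3 : opHom h p (opHom h p (R (R x))) = ((opHom h p * R) ^ 2) x := by
    refine hap (?_ : opHom h p * (opHom h p * (R * R)) = (opHom h p * R) ^ 2) x
    rw [hPR.mul_pow, sq, sq, mul_assoc]
  have e4 : opHom h q (opHom h q (R (R x))) = x := by
    refine hap (?_ : opHom h q * (opHom h q * (R * R)) = 1) x
    rw [← mul_assoc _ R, hQR, one_mul, hQR]
  rw [e1, e2, e3, e4, inner_self_eq_norm_sq_to_K] at h1
  simp only [norm_pow, Complex.norm_real, norm_norm, Complex.coe_algebraMap] at h1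
  have h2 : ‖(opHom h p * R) x‖ ^ 2 ≤ ‖(opHom h p * R) ^ 2‖ * ‖x‖ ^ 2 := by
    calc _ ≤ ‖((opHom h p * R) ^ 2) x‖ * ‖x‖ := by simpa using h1
      _ ≤ ‖(opHom h p * R) ^ 2‖ * ‖x‖ * ‖x‖ := by
        gcongr
        exact ContinuousLinearMap.le_opNorm _ _
      _ = _ := by ring
  rw [← Real.sqrt_sq (norm_nonneg x), ← Real.sqrt_mul (norm_nonneg _)]
  exact Real.le_sqrt_of_sq_le h2

omit [CompleteSpace H] in
theorem mul_inverse_opHom_sq {S P : H →L[ℂ] H} (h : Commute S P) (p : MvPolynomial (Fin 2) ℂ)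
    {q : MvPolynomial (Fin 2) ℂ} (hq : IsUnit (opHom h q)) :
    (opHom h p * Ring.inverse (opHom h q)) ^ 2
      = opHom h (p ^ 2) * Ring.inverse (opHom h (q ^ 2)) := by
  obtain ⟨u, hu⟩ := hq
  have hc : Commute (opHom h p) (↑u⁻¹ : H →L[ℂ] H) := by
    refine Commute.units_inv_right ?_
    rw [hu]
    exact commute_opHom_opHom h p q
  rw [map_pow, map_pow, ← hu, ← Units.val_pow_eq_pow_val, Ring.inverse_unit, Ring.inverse_unit,
    hc.mul_pow, ← Units.val_pow_eq_pow_val, inv_pow]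

theorem norm_pow_two_pow_of_isometry {T V : H →L[ℂ] H} (h : Commute T V) (hV : star V * V = 1)
    (hT : star T * V = T) (n : ℕ) : ∀ (p q : MvPolynomial (Fin 2) ℂ), IsUnit (opHom h q) →
      ‖opHom h p * Ring.inverse (opHom h q)‖₊ ^ 2 ^ n
        = ‖(opHom h p * Ring.inverse (opHom h q)) ^ 2 ^ n‖₊ := by
  induction n with
  | zero => simp
  | succ n ih =>
    intro p q hq
    have h1 : ‖opHom h p * Ring.inverse (opHom h q)‖₊ ^ 2
        = ‖(opHom h p * Ring.inverse (opHom h q)) ^ 2‖₊ :=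
      le_antisymm (norm_sq_le_of_isometry h hV hT p hq) (nnnorm_pow_le' _ two_pos)
    rw [pow_succ', pow_mul, h1, pow_mul, mul_inverse_opHom_sq h p hq]
    exact ih _ _ (by rw [map_pow]; exact hq.pow 2)

theorem spectralRadius_eq_nnnorm_of_isometry {T V : H →L[ℂ] H} (h : Commute T V)
    (hV : star V * V = 1) (hT : star T * V = T) (p : MvPolynomial (Fin 2) ℂ)
    {q : MvPolynomial (Fin 2) ℂ} (hq : IsUnit (opHom h q)) :
    spectralRadius ℂ (opHom h p * Ring.inverse (opHom h q))
      = ‖opHom h p * Ring.inverse (opHom h q)‖₊ := by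
  refine tendsto_nhds_unique ?_ tendsto_const_nhds
    (f := fun _ : ℕ => (‖opHom h p * Ring.inverse (opHom h q)‖₊ : ℝ≥0∞)) (l := Filter.atTop)
  convert! (spectrum.pow_nnnorm_pow_one_div_tendsto_nhds_spectralRadius
    (opHom h p * Ring.inverse (opHom h q))).comp
      (tendsto_pow_atTop_atTop_of_one_lt one_lt_two) using 1
  refine funext fun n => ?_
  rw [Function.comp_apply, ← norm_pow_two_pow_of_isometry h hV hT n p q hq, ENNReal.coe_pow,
    ← ENNReal.rpow_natCast, ← ENNReal.rpow_mul]
  simp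

/-- A commuting pair with `V` isometric, `T = T* V` and spectrum in `Γ` is a `Γ`-contraction:
rational functions of it have norm equal to their spectral radius. -/
theorem isGammaContraction_of_isometry {T V : H →L[ℂ] H} (h : Commute T V)
    (hV : star V * V = 1) (hT : star T * V = T) (hG : SpectrumInGamma h) :
    IsGammaContraction T V where
  commute := h
  taylorSpectrum_subset := hG.taylorSpectrum_subset
  isUnit_opEval q hq := by
    rw [opEval_eq h]
    exact hG.isUnit hq
  vonNeumann p q hq := by
    rw [opEval_eq h, opEval_eq h]
    have h1 := hG.spectralRadius_le p hq
    rw [spectralRadius_eq_nnnorm_of_isometry h hV hT p (hG.isUnit hq), ← enorm_eq_nnnorm,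
      ← ofReal_norm] at h1
    refine (ENNReal.ofReal_le_ofReal_iff ?_).1 h1
    refine Real.sSup_nonneg ?_
    rintro _ ⟨z, -, rfl⟩
    exact norm_nonneg _

end Isometry

/-! ### Defect space and fundamental operator -/

section Fundamental

open ComplexConjugate

variable {H : Type*} [NormedAddCommGroup H] [InnerProductSpace ℂ H]

theorem IsGammaContraction.norm_le_one {S P : H →L[ℂ] H} (h : IsGammaContraction S P) :
    ‖P‖ ≤ 1 := by
  have h1 := h.vonNeumann (MvPolynomial.X 1) 1 (by simp)
  rw [opEval_eq h.commute, opEval_eq h.commute] at h1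
  simp only [opHom_X_one, map_one, Ring.inverse_one, mul_one] at h1
  refine h1.trans (Real.sSup_le ?_ zero_le_one)
  rintro _ ⟨z, hz, rfl⟩
  simpa using norm_snd_le_of_mem_Gamma hz

/-- On `Γ` one has `|2 β p - s| ≤ |2 - β s|` for unimodular `β`. -/
theorem norm_two_mul_sub_le {l : ℂ × ℂ} (hl : l ∈ Gamma) {β : ℂ} (hβ : ‖β‖ = 1) :
    ‖2 * β * l.2 - l.1‖ ≤ ‖2 - β * l.1‖ := by
  obtain ⟨⟨z, w⟩, ⟨hz, hw⟩, rfl⟩ := hl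
  simp only [symmetrize] at *
  refine (abs_le_of_sq_le_sq' ?_ (norm_nonneg _)).2
  have h1 : ‖2 - β * (z + w)‖ ^ 2 - ‖2 * β * (z * w) - (z + w)‖ ^ 2
      = 4 * (1 - ‖z‖ ^ 2 * ‖w‖ ^ 2 - (β * z).re * (1 - ‖w‖ ^ 2) - (β * w).re * (1 - ‖z‖ ^ 2)) := by
    have hb : β.re * β.re + β.im * β.im = 1 := by
      rw [← Complex.normSq_apply, Complex.normSq_eq_norm_sq, hβ, one_pow]
    simp only [← Complex.normSq_eq_norm_sq, Complex.normSq_apply, Complex.sub_re, Complex.sub_im,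
      Complex.mul_re, Complex.mul_im, Complex.add_re, Complex.add_im, Complex.re_ofNat,
      Complex.im_ofNat]
    linear_combination (((z.re + w.re) ^ 2 + (z.im + w.im) ^ 2)
      - 4 * (z.re * z.re + z.im * z.im) * (w.re * w.re + w.im * w.im)) * hb
  have h2 : (β * z).re ≤ ‖z‖ := (Complex.re_le_norm _).trans (by rw [norm_mul, hβ, one_mul])
  have h3 : (β * w).re ≤ ‖w‖ := (Complex.re_le_norm _).trans (by rw [norm_mul, hβ, one_mul])
  have hz0 := norm_nonneg z
  have hw0 := norm_nonneg w
  have h4 : (β * z).re * (1 - ‖w‖ ^ 2) ≤ ‖z‖ * (1 - ‖w‖ ^ 2) :=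
    mul_le_mul_of_nonneg_right h2 (by nlinarith)
  have h5 : (β * w).re * (1 - ‖z‖ ^ 2) ≤ ‖w‖ * (1 - ‖z‖ ^ 2) :=
    mul_le_mul_of_nonneg_right h3 (by nlinarith)
  have h6 : 0 ≤ (1 - ‖z‖) * (1 - ‖w‖) * (1 - ‖z‖ * ‖w‖) :=
    mul_nonneg (mul_nonneg (by linarith) (by linarith)) (by nlinarith)
  nlinarith

/-- Von Neumann's inequality for the rational functions `(2 β p - s) / (2 t - β s)`, `t > 1`. -/
theorem IsGammaContraction.norm_apply_le_of_one_lt {S P : H →L[ℂ] H} (h : IsGammaContraction S P)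
    {β : ℂ} (hβ : ‖β‖ = 1) {t : ℝ} (ht : 1 < t) (x : H) :
    ‖(2 * β) • P x - S x‖ ≤ ‖(2 * t : ℂ) • x - β • S x‖ := by
  set p : MvPolynomial (Fin 2) ℂ :=
    MvPolynomial.C (2 * β) * MvPolynomial.X 1 - MvPolynomial.X 0 with hp
  set q : MvPolynomial (Fin 2) ℂ :=
    MvPolynomial.C (2 * t : ℂ) - MvPolynomial.C β * MvPolynomial.X 0 with hq
  have hpe : ∀ l, polyEval p l = 2 * β * l.2 - l.1 := fun l => by
    simp only [hp, polyEval_sub, polyEval_mul, polyEval_C, polyEval_X_zero, polyEval_X_one]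
  have hqe : ∀ l, polyEval q l = 2 * t - β * l.1 := fun l => by
    simp only [hq, polyEval_sub, polyEval_mul, polyEval_C, polyEval_X_zero]
  have hle : ∀ l ∈ Gamma, ‖2 - β * l.1‖ ≤ ‖2 * t - β * l.1‖ := fun l hl => by
    have h1 : (β * l.1).re ≤ 2 := (Complex.re_le_norm _).trans
      (by rw [norm_mul, hβ, one_mul]; exact norm_fst_le_of_mem_Gamma hl)
    refine (abs_le_of_sq_le_sq' ?_ (norm_nonneg _)).2
    generalize β * l.1 = w at h1
    simp only [← Complex.normSq_eq_norm_sq, Complex.normSq_apply, Complex.sub_re, Complex.sub_im,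
      Complex.re_ofNat, Complex.im_ofNat, Complex.mul_re, Complex.mul_im, Complex.ofReal_re,
      Complex.ofReal_im]
    nlinarith
  have hq0 : ∀ l ∈ Gamma, polyEval q l ≠ 0 := fun l hl h0 => by
    have h1 : ‖β * l.1‖ ≤ 2 := by
      rw [norm_mul, hβ, one_mul]; exact norm_fst_le_of_mem_Gamma hl
    rw [hqe, sub_eq_zero] at h0
    rw [← h0, norm_mul, Complex.norm_real, Real.norm_of_nonneg (by linarith)] at h1
    norm_num at h1
    linarith
  have h1 := h.vonNeumann p q hq0
  have h2 : ‖opEval p S P * Ring.inverse (opEval q S P)‖ ≤ 1 := by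
    refine h1.trans (Real.sSup_le ?_ zero_le_one)
    rintro _ ⟨l, hl, rfl⟩
    simp only [norm_div]
    refine div_le_one_of_le₀ ?_ (norm_nonneg _)
    rw [hpe, hqe]
    exact (norm_two_mul_sub_le hl hβ).trans (hle l hl)
  have hu := h.isUnit_opEval q hq0
  have h3 : opEval p S P x
      = (opEval p S P * Ring.inverse (opEval q S P)) (opEval q S P x) := by
    rw [← mul_apply_eq_comp, mul_assoc, Ring.inverse_mul_cancel _ hu, mul_one]
  have h4 : ‖opEval p S P x‖ ≤ ‖opEval q S P x‖ := by
    rw [h3]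
    exact (ContinuousLinearMap.le_of_opNorm_le _ h2 _).trans (by rw [one_mul])
  rw [opEval_eq h.commute, opEval_eq h.commute, hp, hq, map_sub, map_sub,
    map_mul (opHom h.commute), map_mul (opHom h.commute),
    opHom_C, opHom_C, opHom_C, opHom_X_zero, opHom_X_one] at h4
  simpa using h4

theorem IsGammaContraction.norm_apply_le {S P : H →L[ℂ] H} (h : IsGammaContraction S P)
    {β : ℂ} (hβ : ‖β‖ = 1) (x : H) :
    ‖(2 * β) • P x - S x‖ ≤ ‖(2 : ℂ) • x - β • S x‖ := by
  have hc : ContinuousAt (fun t : ℝ => ‖(2 * t : ℂ) • x - β • S x‖) 1 := by fun_prop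
  have h1 : Filter.Tendsto (fun t : ℝ => ‖(2 * t : ℂ) • x - β • S x‖) (nhdsWithin 1 (Set.Ioi 1))
      (nhds ‖(2 : ℂ) • x - β • S x‖) := by
    have := hc.tendsto.mono_left (nhdsWithin_le_nhds (s := Set.Ioi 1))
    simpa using this
  refine ge_of_tendsto h1 ?_
  filter_upwards [self_mem_nhdsWithin] with t ht
  exact h.norm_apply_le_of_one_lt hβ ht x

variable [CompleteSpace H]

theorem IsGammaContraction.re_mul_inner_le {S P : H →L[ℂ] H} (h : IsGammaContraction S P)
    {β : ℂ} (hβ : ‖β‖ = 1) (x : H) :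
    (β * ⟪x, (S - star S * P) x⟫_ℂ).re ≤ ‖x‖ ^ 2 - ‖P x‖ ^ 2 := by
  have h1 := h.norm_apply_le hβ x
  have h2 := pow_le_pow_left₀ (norm_nonneg _) h1 2
  rw [@norm_sub_sq ℂ, @norm_sub_sq ℂ] at h2
  simp only [norm_smul, inner_smul_left, inner_smul_right, norm_mul, hβ, Complex.norm_ofNat,
    map_mul, Complex.conj_ofNat] at h2
  have h3 : ⟪x, (S - star S * P) x⟫_ℂ = ⟪x, S x⟫_ℂ - ⟪S x, P x⟫_ℂ := by
    rw [sub_apply, inner_sub_right, mul_apply_eq_comp,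
      ContinuousLinearMap.star_eq_adjoint, ContinuousLinearMap.adjoint_inner_right]
  rw [h3, mul_sub, Complex.sub_re]
  have h4 : (conj β * ⟪P x, S x⟫_ℂ).re = (β * ⟪S x, P x⟫_ℂ).re := by
    rw [← inner_conj_symm, ← map_mul, Complex.conj_re]
  have h5 : ∀ c : ℂ, (2 * c).re = 2 * c.re := fun c => by simp
  simp only [RCLike.re_to_complex, mul_assoc, mul_left_comm β 2, h5, h4] at h2
  nlinarith

theorem norm_le_of_forall_re_mul_le {c : ℂ} {r : ℝ} (h : ∀ β : ℂ, ‖β‖ = 1 → (β * c).re ≤ r) :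
    ‖c‖ ≤ r := by
  obtain ⟨β, hβ, h1⟩ := Complex.exists_norm_mul_eq_self c
  have h0 : β ≠ 0 := norm_ne_zero_iff.1 (by rw [hβ]; exact one_ne_zero)
  have h2 := h β⁻¹ (by rw [norm_inv, hβ, inv_one])
  rwa [← h1, ← mul_assoc, inv_mul_cancel₀ h0, one_mul, Complex.ofReal_re] at h2

theorem defectOp_mul_self {P : H →L[ℂ] H} (hP : ‖P‖ ≤ 1) :
    defectOp P * defectOp P = 1 - star P * P := by
  refine CFC.sqrt_mul_sqrt_self _ ?_
  rw [ContinuousLinearMap.nonneg_iff_isPositive]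
  refine ⟨?_, fun x => ?_⟩
  · rw [← ContinuousLinearMap.isSelfAdjoint_iff_isSymmetric]
    exact (IsSelfAdjoint.one _).sub (IsSelfAdjoint.star_mul_self P)
  · rw [ContinuousLinearMap.reApplyInnerSelf, sub_apply, inner_sub_left,
      mul_apply_eq_comp, ContinuousLinearMap.star_eq_adjoint,
      ContinuousLinearMap.adjoint_inner_left, map_sub, one_apply_eq_self,
      inner_self_eq_norm_sq, inner_self_eq_norm_sq]
    have h1 : ‖P x‖ ≤ ‖x‖ := (P.le_of_opNorm_le hP x).trans (by rw [one_mul])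
    have := norm_nonneg (P x)
    nlinarith

theorem isSelfAdjoint_defectOp (P : H →L[ℂ] H) : IsSelfAdjoint (defectOp P) :=
  IsSelfAdjoint.of_nonneg (CFC.sqrt_nonneg _)

theorem coe_defectMap (P : H →L[ℂ] H) (x : H) : (defectMap P x : H) = defectOp P x := rfl

theorem adjoint_defectMap (P : H →L[ℂ] H) :
    ContinuousLinearMap.adjoint (defectMap P) = defectOp P ∘L (defectSpace P).subtypeL := by
  symm
  rw [ContinuousLinearMap.eq_adjoint_iff]
  intro u x
  rw [Submodule.coe_inner, coe_defectMap, ContinuousLinearMap.comp_apply, Submodule.subtypeL_apply,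
    ← ContinuousLinearMap.adjoint_inner_right, ← ContinuousLinearMap.star_eq_adjoint,
    (isSelfAdjoint_defectOp P).star_eq]

theorem inner_defectMap {P : H →L[ℂ] H} (hP : ‖P‖ ≤ 1) (x y : H) :
    ⟪defectMap P x, defectMap P y⟫_ℂ = ⟪x, y⟫_ℂ - ⟪P x, P y⟫_ℂ := by
  rw [← ContinuousLinearMap.adjoint_inner_right, adjoint_defectMap,
    ContinuousLinearMap.comp_apply, Submodule.subtypeL_apply, coe_defectMap, ← mul_apply_eq_comp,
    defectOp_mul_self hP, sub_apply, inner_sub_right, mul_apply_eq_comp,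
      ContinuousLinearMap.star_eq_adjoint, ContinuousLinearMap.adjoint_inner_right,
      one_apply_eq_self]

theorem norm_defectMap_sq {P : H →L[ℂ] H} (hP : ‖P‖ ≤ 1) (x : H) :
    ‖defectMap P x‖ ^ 2 = ‖x‖ ^ 2 - ‖P x‖ ^ 2 := by
  have h := inner_defectMap hP x x
  simp only [inner_self_eq_norm_sq_to_K] at h
  exact_mod_cast h

theorem defectMap_surjective (P : H →L[ℂ] H) [FiniteDimensional ℂ (defectSpace P)] :
    Function.Surjective (defectMap P) := by
  have h1 : FiniteDimensional ℂ (LinearMap.range (defectOp P : H →ₗ[ℂ] H)) :=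
    have : FiniteDimensional ℂ
        (LinearMap.range (defectOp P : H →ₗ[ℂ] H)).topologicalClosure :=
      inferInstanceAs (FiniteDimensional ℂ (defectSpace P))
    Submodule.finiteDimensional_of_le (Submodule.le_topologicalClosure _)
  have h2 : defectSpace P = LinearMap.range (defectOp P : H →ₗ[ℂ] H) :=
    (Submodule.closed_of_finiteDimensional _).submodule_topologicalClosure_eq
  rintro ⟨u, hu⟩
  obtain ⟨x, hx⟩ := h2 ▸ hu
  exact ⟨x, Subtype.ext hx⟩

/-- The weak form of the fundamental equation. -/
theorem isFundamentalOperator_iff {S P : H →L[ℂ] H} {A : defectSpace P →L[ℂ] defectSpace P} :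
    IsFundamentalOperator S P A ↔
      ∀ y x, ⟪y, (S - star S * P) x⟫_ℂ = ⟪defectMap P y, A (defectMap P x)⟫_ℂ := by
  unfold IsFundamentalOperator
  have h : defectOp P ∘L (defectSpace P).subtypeL ∘L A ∘L defectMap P
      = ContinuousLinearMap.adjoint (defectMap P) ∘L A ∘L defectMap P := by
    rw [adjoint_defectMap, ContinuousLinearMap.comp_assoc]
  rw [h]
  constructor
  · intro h1 y x
    rw [h1, ContinuousLinearMap.comp_apply, ContinuousLinearMap.adjoint_inner_right]
    rfl
  · intro h1
    refine ContinuousLinearMap.ext fun x => ext_inner_left ℂ fun y => ?_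
    rw [h1, ContinuousLinearMap.comp_apply, ContinuousLinearMap.adjoint_inner_right]
    rfl

theorem IsGammaContraction.norm_inner_le {S P : H →L[ℂ] H} (h : IsGammaContraction S P) (x : H) :
    ‖⟪x, (S - star S * P) x⟫_ℂ‖ ≤ ‖defectMap P x‖ ^ 2 := by
  rw [norm_defectMap_sq h.norm_le_one]
  exact norm_le_of_forall_re_mul_le fun β hβ => h.re_mul_inner_le hβ x

omit [CompleteSpace H] in
/-- A quadratic-form bound by `‖D x‖²` passes to the sesquilinear form by polarization. -/
theorem norm_inner_le_add {K : Type*} [NormedAddCommGroup K] [InnerProductSpace ℂ K]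
    {B : H →L[ℂ] H} {D : H →L[ℂ] K}
    (h : ∀ x, ‖⟪x, B x⟫_ℂ‖ ≤ ‖D x‖ ^ 2) (x y : H) : ‖⟪y, B x⟫_ℂ‖ ≤ ‖D x‖ ^ 2 + ‖D y‖ ^ 2 := by
  have h1 : 4 * ⟪y, B x⟫_ℂ = ⟪y + x, B (y + x)⟫_ℂ - ⟪y - x, B (y - x)⟫_ℂ
      - Complex.I * ⟪y + Complex.I • x, B (y + Complex.I • x)⟫_ℂ
      + Complex.I * ⟪y - Complex.I • x, B (y - Complex.I • x)⟫_ℂ := by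
    simp only [map_add, map_sub, map_smul, inner_add_left, inner_add_right, inner_sub_left,
      inner_sub_right, inner_smul_left, inner_smul_right, Complex.conj_I]
    linear_combination (2 * ⟪y, B x⟫_ℂ - 2 * ⟪x, B y⟫_ℂ) * Complex.I_mul_I
  have hI : ‖D (Complex.I • x)‖ = ‖D x‖ := by simp [norm_smul]
  have e1 : ‖D (y + x)‖ ^ 2 + ‖D (y - x)‖ ^ 2 = 2 * (‖D y‖ ^ 2 + ‖D x‖ ^ 2) := by
    have := parallelogram_law_with_norm ℂ (D y) (D x)
    rw [map_add, map_sub]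
    linarith
  have e2 : ‖D (y + Complex.I • x)‖ ^ 2 + ‖D (y - Complex.I • x)‖ ^ 2
      = 2 * (‖D y‖ ^ 2 + ‖D x‖ ^ 2) := by
    have := parallelogram_law_with_norm ℂ (D y) (D (Complex.I • x))
    rw [map_add, map_sub, ← hI]
    linarith
  have h2 : ‖4 * ⟪y, B x⟫_ℂ‖ ≤ ‖D (y + x)‖ ^ 2 + ‖D (y - x)‖ ^ 2
      + ‖D (y + Complex.I • x)‖ ^ 2 + ‖D (y - Complex.I • x)‖ ^ 2 := by
    rw [h1]
    refine (norm_add_le _ _).trans (add_le_add ((norm_sub_le _ _).trans (add_le_add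
      ((norm_sub_le _ _).trans (add_le_add (h _) (h _))) ?_)) ?_)
    · rw [norm_mul, Complex.norm_I, one_mul]; exact h _
    · rw [norm_mul, Complex.norm_I, one_mul]; exact h _
  rw [norm_mul, Complex.norm_ofNat] at h2
  linarith

omit [CompleteSpace H] in
theorem inner_eq_zero_of_apply_eq_zero {K : Type*} [NormedAddCommGroup K] [InnerProductSpace ℂ K]
    {B : H →L[ℂ] H} {D : H →L[ℂ] K} (h : ∀ x, ‖⟪x, B x⟫_ℂ‖ ≤ ‖D x‖ ^ 2) {x y : H}
    (hxy : D x = 0 ∨ D y = 0) : ⟪y, B x⟫_ℂ = 0 := by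
  -- scale the vector not known to lie in the kernel by a small `t`
  have key : ∀ c d : ℝ, 0 ≤ c → (∀ t : ℝ, 0 < t → t * c ≤ t ^ 2 * d) → c ≤ 0 := by
    intro c d hc h1
    by_contra! hc'
    have hd : 0 < |d| + 1 := by positivity
    have ht : 0 < c / (2 * (|d| + 1)) := by positivity
    have h2 := h1 _ ht
    rw [sq, mul_assoc, mul_le_mul_iff_right₀ ht, div_mul_eq_mul_div, le_div_iff₀ (by positivity)]
      at h2
    nlinarith [le_abs_self d, abs_nonneg d]
  rw [← norm_le_zero_iff]
  rcases hxy with h0 | h0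
  · refine key _ (‖D y‖ ^ 2) (norm_nonneg _) fun t ht => ?_
    have h1 := norm_inner_le_add h x ((t : ℂ) • y)
    rw [h0, inner_smul_left, norm_mul, map_smul, norm_smul, Complex.conj_ofReal,
      Complex.norm_real, Real.norm_of_nonneg ht.le, norm_zero] at h1
    linarith
  · refine key _ (‖D x‖ ^ 2) (norm_nonneg _) fun t ht => ?_
    have h1 := norm_inner_le_add h ((t : ℂ) • x) y
    rw [h0, map_smul, inner_smul_right, norm_mul, map_smul, norm_smul,
      Complex.norm_real, Real.norm_of_nonneg ht.le, norm_zero] at h1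
    linarith

/-- Existence: if `G` is a section of `D_P : H → 𝒟_P`, then `A = G* (S - S* P) G` solves the
fundamental equation, as `S - S* P` and its adjoint vanish on `ker D_P`. -/
theorem IsGammaContraction.exists_isFundamentalOperator {S P : H →L[ℂ] H}
    (h : IsGammaContraction S P) [FiniteDimensional ℂ (defectSpace P)] :
    ∃ A, IsFundamentalOperator S P A := by
  obtain ⟨g, hg⟩ := (defectMap P : H →ₗ[ℂ] defectSpace P).exists_rightInverse_of_surjective
    (LinearMap.range_eq_top.2 (defectMap_surjective P))
  set G : defectSpace P →L[ℂ] H := LinearMap.toContinuousLinearMap g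
  have hG : ∀ u, defectMap P (G u) = u := fun u => LinearMap.congr_fun hg u
  refine ⟨ContinuousLinearMap.adjoint G ∘L (S - star S * P) ∘L G, ?_⟩
  rw [isFundamentalOperator_iff]
  intro y x
  rw [ContinuousLinearMap.comp_apply, ContinuousLinearMap.adjoint_inner_right,
    ContinuousLinearMap.comp_apply]
  have hker : ∀ x, defectMap P (x - G (defectMap P x)) = 0 := fun x => by
    rw [map_sub, hG, sub_self]
  have h1 : ⟪y, (S - star S * P) (x - G (defectMap P x))⟫_ℂ = 0 :=
    inner_eq_zero_of_apply_eq_zero h.norm_inner_le (Or.inl (hker x))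
  have h2 : ⟪y - G (defectMap P y), (S - star S * P) (G (defectMap P x))⟫_ℂ = 0 :=
    inner_eq_zero_of_apply_eq_zero h.norm_inner_le (Or.inr (hker y))
  rw [map_sub, inner_sub_right, sub_eq_zero] at h1
  rw [inner_sub_left, sub_eq_zero] at h2
  rw [h1, h2]

theorem IsFundamentalOperator.unique {S P : H →L[ℂ] H} [FiniteDimensional ℂ (defectSpace P)]
    {A B : defectSpace P →L[ℂ] defectSpace P} (hA : IsFundamentalOperator S P A)
    (hB : IsFundamentalOperator S P B) : A = B := by
  rw [isFundamentalOperator_iff] at hA hB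
  refine ContinuousLinearMap.ext fun u => ext_inner_left ℂ fun v => ?_
  obtain ⟨x, rfl⟩ := defectMap_surjective P u
  obtain ⟨y, rfl⟩ := defectMap_surjective P v
  rw [← hA, hB]

/-- The numerical radius of the fundamental operator is at most one. -/
theorem IsFundamentalOperator.norm_inner_le {S P : H →L[ℂ] H} (h : IsGammaContraction S P)
    [FiniteDimensional ℂ (defectSpace P)] {A : defectSpace P →L[ℂ] defectSpace P}
    (hA : IsFundamentalOperator S P A) (u : defectSpace P) : ‖⟪u, A u⟫_ℂ‖ ≤ ‖u‖ ^ 2 := by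
  obtain ⟨x, rfl⟩ := defectMap_surjective P u
  rw [← isFundamentalOperator_iff.1 hA]
  exact h.norm_inner_le x

/-- The relation `D_P S = A D_P + A* D_P P`. -/
theorem IsFundamentalOperator.defectMap_comp {S P : H →L[ℂ] H} (h : IsGammaContraction S P)
    [FiniteDimensional ℂ (defectSpace P)] {A : defectSpace P →L[ℂ] defectSpace P}
    (hA : IsFundamentalOperator S P A) (x : H) :
    defectMap P (S x) = A (defectMap P x) + star A (defectMap P (P x)) := by
  refine ext_inner_left ℂ fun u => ?_
  obtain ⟨y, rfl⟩ := defectMap_surjective P u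
  rw [isFundamentalOperator_iff] at hA
  have hadj : ∀ (B : H →L[ℂ] H) (x z : H), ⟪x, star B z⟫_ℂ = ⟪B x, z⟫_ℂ := fun B x z => by
    rw [ContinuousLinearMap.star_eq_adjoint, ContinuousLinearMap.adjoint_inner_right]
  have h1 : ⟪defectMap P y, star A (defectMap P (P x))⟫_ℂ = ⟪S y, P x⟫_ℂ - ⟪P y, S (P x)⟫_ℂ := by
    rw [ContinuousLinearMap.star_eq_adjoint, ContinuousLinearMap.adjoint_inner_right,
      ← inner_conj_symm, ← hA]
    simp only [sub_apply, inner_sub_right, map_sub, mul_apply_eq_comp,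
      hadj, inner_conj_symm]
  have hc : S (P x) = P (S x) := congrArg (fun B : H →L[ℂ] H => B x) h.commute.eq
  rw [inner_add_right, ← hA, h1, inner_defectMap h.norm_le_one, sub_apply,
    inner_sub_right, mul_apply_eq_comp, hadj, hc]
  ring

end Fundamental

/-! ### The pair `(A + M_z A*, M_z)` on `ℓ²` -/

section Toeplitz

open ComplexConjugate

variable {E : Type*} [NormedAddCommGroup E] [InnerProductSpace ℂ E]

theorem diagOp_apply (A : E →L[ℂ] E) (x : Ell2 E) (n : ℕ) : diagOp A x n = A (x n) := rfl

theorem shiftOp_apply_zero (x : Ell2 E) : shiftOp x 0 = 0 := rfl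

/-- The operators `diagOp A` as an algebra homomorphism. -/
def diagHom : (E →L[ℂ] E) →ₐ[ℂ] (Ell2 E →L[ℂ] Ell2 E) where
  toFun := diagOp
  map_one' := by ext; rfl
  map_mul' _ _ := by ext; rfl
  map_zero' := by ext; rfl
  map_add' _ _ := by ext; rfl
  commutes' _ := by ext; rfl

theorem diagHom_apply (A : E →L[ℂ] E) : diagHom A = diagOp A := rfl

theorem commute_shiftOp_diagOp (A : E →L[ℂ] E) : Commute (shiftOp (E := E)) (diagOp A) := by
  refine ContinuousLinearMap.ext fun x => lp.ext (funext fun n => ?_)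
  cases n with
  | zero => exact (map_zero A).symm
  | succ n => rfl

theorem norm_shiftOp_apply (x : Ell2 E) : ‖shiftOp x‖ = ‖x‖ := by
  have h := lp.hasSum_norm (p := 2) (by norm_num) (shiftOp x)
  have h2 := h.unique (hasSum_shiftFun x)
  exact (Real.rpow_left_inj (norm_nonneg _) (norm_nonneg _) (by norm_num)).1 h2

variable [CompleteSpace E]

theorem star_shiftOp_mul : star (shiftOp (E := E)) * shiftOp = 1 := by
  rw [ContinuousLinearMap.star_eq_adjoint, ContinuousLinearMap.mul_def, ContinuousLinearMap.one_def]
  exact (ContinuousLinearMap.norm_map_iff_adjoint_comp_self _).1 norm_shiftOp_apply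

theorem star_diagOp (A : E →L[ℂ] E) : star (diagOp A) = diagOp (star A) := by
  rw [ContinuousLinearMap.star_eq_adjoint]
  symm
  rw [ContinuousLinearMap.eq_adjoint_iff]
  intro x y
  rw [lp.inner_eq_tsum, lp.inner_eq_tsum]
  refine tsum_congr fun n => ?_
  rw [diagOp_apply, diagOp_apply, ContinuousLinearMap.star_eq_adjoint,
    ContinuousLinearMap.adjoint_inner_left]

/-- The operator `A + M_z A*` on `ℓ²(E)`, where `M_z` is the shift. -/
def toeplitzOp (A : E →L[ℂ] E) : Ell2 E →L[ℂ] Ell2 E :=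
  diagOp A + shiftOp ∘L diagOp (star A)

theorem toeplitzOp_eq (A : E →L[ℂ] E) :
    toeplitzOp A = diagOp A + shiftOp * diagOp (star A) := rfl

theorem commute_toeplitzOp (A : E →L[ℂ] E) : Commute (toeplitzOp A) shiftOp :=
  ((commute_shiftOp_diagOp A).add_right
    ((Commute.refl _).mul_right (commute_shiftOp_diagOp (star A)))).symm

theorem star_toeplitzOp_mul (A : E →L[ℂ] E) : star (toeplitzOp A) * shiftOp = toeplitzOp A := by
  rw [toeplitzOp_eq, star_add, star_mul, star_diagOp, star_diagOp, star_star, add_mul, mul_assoc,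
    star_shiftOp_mul, mul_one, ← (commute_shiftOp_diagOp (star A)).eq, add_comm]

end Toeplitz

/-! ### The determinant polynomial `det (A + p A* - s)` -/

section Determinant

open ComplexConjugate

variable {E : Type*} [NormedAddCommGroup E] [InnerProductSpace ℂ E] [FiniteDimensional ℂ E]
  [CompleteSpace E]

/-- The matrix `A + p A* - s` in an orthonormal basis, with entries in `ℂ[s, p]`. -/
def pencilMatrix (A : E →L[ℂ] E) :
    Matrix (Fin (Module.finrank ℂ E)) (Fin (Module.finrank ℂ E)) (MvPolynomial (Fin 2) ℂ) :=
  Matrix.of fun i j =>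
    MvPolynomial.C ⟪stdOrthonormalBasis ℂ E i, A (stdOrthonormalBasis ℂ E j)⟫_ℂ +
      MvPolynomial.X 1 *
        MvPolynomial.C ⟪stdOrthonormalBasis ℂ E i, star A (stdOrthonormalBasis ℂ E j)⟫_ℂ -
      if i = j then MvPolynomial.X 0 else 0

/-- The polynomial `det (A + p A* - s)`. -/
def pencilPoly (A : E →L[ℂ] E) : MvPolynomial (Fin 2) ℂ := (pencilMatrix A).det

/-- The rank one operator `x ↦ ⟪bₖ, x⟫ bᵢ` for the standard orthonormal basis. -/
def matrixUnit (i k : Fin (Module.finrank ℂ E)) : E →L[ℂ] E :=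
  (innerSL ℂ (stdOrthonormalBasis ℂ E k)).smulRight (stdOrthonormalBasis ℂ E i)

omit [CompleteSpace E] in
theorem sum_smul_matrixUnit (B : E →L[ℂ] E) (j k : Fin (Module.finrank ℂ E)) :
    ∑ i, ⟪stdOrthonormalBasis ℂ E i, B (stdOrthonormalBasis ℂ E j)⟫_ℂ • matrixUnit i k
      = B * matrixUnit j k := by
  refine ContinuousLinearMap.ext fun x => ?_
  rw [sum_apply, mul_apply_eq_comp]
  simp only [matrixUnit, smul_apply, ContinuousLinearMap.smulRight_apply,
    innerSL_apply_apply, map_smul]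
  conv_rhs => rw [← (stdOrthonormalBasis ℂ E).sum_repr' (B (stdOrthonormalBasis ℂ E j))]
  rw [Finset.smul_sum]
  exact Finset.sum_congr rfl fun i _ => smul_comm _ _ _

omit [CompleteSpace E] in
theorem sum_matrixUnit : ∑ k, matrixUnit k k = (1 : E →L[ℂ] E) := by
  refine ContinuousLinearMap.ext fun x => ?_
  rw [sum_apply]
  exact (stdOrthonormalBasis ℂ E).sum_repr' x

/-- The columns of `A + p A* - s`, evaluated at `(A + M_z A*, M_z)`, are linear relations between
the matrix units in a fixed column. -/
theorem sum_opHom_pencilMatrix (A : E →L[ℂ] E) (j k : Fin (Module.finrank ℂ E)) :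
    ∑ i, opHom (commute_toeplitzOp A) (pencilMatrix A i j) * diagOp (matrixUnit i k) = 0 := by
  have h1 : ∀ i, opHom (commute_toeplitzOp A) (pencilMatrix A i j) * diagOp (matrixUnit i k)
      = diagHom (⟪stdOrthonormalBasis ℂ E i, A (stdOrthonormalBasis ℂ E j)⟫_ℂ • matrixUnit i k)
        + shiftOp * diagHom
          (⟪stdOrthonormalBasis ℂ E i, star A (stdOrthonormalBasis ℂ E j)⟫_ℂ • matrixUnit i k)
        - if i = j then toeplitzOp A * diagHom (matrixUnit i k) else 0 := by
    intro i
    simp only [pencilMatrix, Matrix.of_apply, map_sub, map_add, opHom_C, opHom_X_one, map_smul,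
      map_mul, sub_mul, add_mul, smul_mul_assoc, one_mul, diagHom_apply, mul_assoc, mul_smul_comm]
    congr 1
    split_ifs <;> simp
  simp only [h1]
  rw [Finset.sum_sub_distrib, Finset.sum_add_distrib, ← map_sum, ← Finset.mul_sum, ← map_sum,
    sum_smul_matrixUnit, sum_smul_matrixUnit, Finset.sum_ite_eq' Finset.univ j]
  simp only [Finset.mem_univ, if_true, map_mul, toeplitzOp_eq, diagHom_apply, add_mul, mul_assoc,
    sub_self]

/-- Cayley–Hamilton over `ℂ[s, p]`: the pair `(A + M_z A*, M_z)` is annihilated by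
`det (A + p A* - s)`. -/
theorem opHom_pencilPoly (A : E →L[ℂ] E) : opHom (commute_toeplitzOp A) (pencilPoly A) = 0 := by
  set φ := opHom (commute_toeplitzOp A)
  have key : ∀ k, φ (pencilPoly A) * diagOp (matrixUnit k k) = 0 := fun k => by
    have h1 : ∀ i, φ (if i = k then pencilPoly A else 0) * diagOp (matrixUnit i k)
        = ∑ j, φ ((pencilMatrix A).adjugate j k) *
          (φ (pencilMatrix A i j) * diagOp (matrixUnit i k)) := fun i => by
      have h2 := congrFun (congrFun (Matrix.mul_adjugate (pencilMatrix A)) i) k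
      rw [Matrix.smul_apply, Matrix.one_apply, smul_eq_mul, mul_ite, mul_one, mul_zero,
        Matrix.mul_apply] at h2
      rw [pencilPoly, ← h2, map_sum, Finset.sum_mul]
      refine Finset.sum_congr rfl fun j _ => ?_
      rw [mul_comm, map_mul, mul_assoc]
    have h3 : ∑ i, φ (if i = k then pencilPoly A else 0) * diagOp (matrixUnit i k)
        = φ (pencilPoly A) * diagOp (matrixUnit k k) := by
      rw [Finset.sum_eq_single k]
      · rw [if_pos rfl]
      · intro i _ hi
        rw [if_neg hi, map_zero, zero_mul]
      · simp
    rw [← h3]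
    simp only [h1]
    rw [Finset.sum_comm]
    refine Finset.sum_eq_zero fun j _ => ?_
    rw [← Finset.mul_sum, sum_opHom_pencilMatrix, mul_zero]
  have h1 : ∑ k, φ (pencilPoly A) * diagHom (matrixUnit k k) = 0 :=
    Finset.sum_eq_zero fun k _ => key k
  rwa [← Finset.mul_sum, ← map_sum, sum_matrixUnit, map_one, mul_one] at h1

theorem exists_eigenvector_of_pencilPoly {A : E →L[ℂ] E} {l : ℂ × ℂ}
    (h : polyEval (pencilPoly A) l = 0) : ∃ x : E, x ≠ 0 ∧ A x + l.2 • star A x = l.1 • x := by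
  set b := stdOrthonormalBasis ℂ E with hb
  rw [pencilPoly, polyEval, RingHom.map_det, ← Matrix.exists_mulVec_eq_zero_iff] at h
  obtain ⟨v, hv, hv0⟩ := h
  refine ⟨∑ j, v j • b j, fun h0 => hv (funext fun i => ?_), ?_⟩
  · have h1 := congrArg (fun x => ⟪b i, x⟫_ℂ) h0
    simpa [inner_sum, inner_smul_right, b.inner_eq_ite] using h1
  · refine b.repr.injective (PiLp.ext fun x => ?_)
    rw [b.repr_apply_apply, b.repr_apply_apply]
    have h1 := congrFun hv0 x
    simp only [Matrix.mulVec, dotProduct, pencilMatrix, RingHom.mapMatrix_apply, Matrix.map_apply,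
      Matrix.of_apply, map_sub, map_add, map_mul, MvPolynomial.eval_C, MvPolynomial.eval_X,
      Pi.zero_apply, ← hb] at h1
    rw [← sub_eq_zero, ← h1, map_sum, map_sum, inner_add_right, inner_smul_right, inner_smul_right,
      inner_sum, inner_sum, inner_sum, Finset.mul_sum, Finset.mul_sum, ← Finset.sum_add_distrib,
      ← Finset.sum_sub_distrib]
    refine Finset.sum_congr rfl fun j _ => ?_
    rw [map_smul, map_smul, inner_smul_right, inner_smul_right, inner_smul_right, b.inner_eq_ite]
    split_ifs <;> simp <;> ring

omit [FiniteDimensional ℂ E] in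
/-- If `(A + p A*) x = s x` and the numerical radius of `A` is at most one, then `s = a + p ā`
with `a = ⟪x, A x⟫ / ‖x‖²`. -/
theorem eq_add_mul_conj {A : E →L[ℂ] E} (hA : ∀ u, ‖⟪u, A u⟫_ℂ‖ ≤ ‖u‖ ^ 2) {x : E} (hx : x ≠ 0)
    {s p : ℂ} (h : A x + p • star A x = s • x) :
    ∃ a : ℂ, ‖a‖ ≤ 1 ∧ s = a + p * conj a ∧ ⟪x, A x⟫_ℂ = a * (‖x‖ : ℂ) ^ 2 := by
  have hx0 : 0 < ‖x‖ := norm_pos_iff.2 hx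
  have hx1 : (‖x‖ : ℂ) ^ 2 ≠ 0 := by exact_mod_cast (pow_pos hx0 2).ne'
  refine ⟨⟪x, A x⟫_ℂ / (‖x‖ : ℂ) ^ 2, ?_, ?_, (div_mul_cancel₀ _ hx1).symm⟩
  · rw [norm_div, norm_pow, Complex.norm_real, norm_norm]
    exact div_le_one_of_le₀ (hA x) (by positivity)
  · have h1 := congrArg (fun y => ⟪x, y⟫_ℂ) h
    simp only [inner_add_right, inner_smul_right] at h1
    rw [ContinuousLinearMap.star_eq_adjoint, ContinuousLinearMap.adjoint_inner_right,
      ← inner_conj_symm, inner_self_eq_norm_sq_to_K] at h1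
    rw [map_div₀, map_pow, Complex.conj_ofReal]
    rw [mul_div_assoc', ← add_div, eq_div_iff hx1, inner_conj_symm]
    rw [inner_conj_symm] at h1
    exact h1.symm

omit [FiniteDimensional ℂ E] in
/-- A unimodular value `a` of the numerical range is extremal, so that `2 - ā A - a A* ≥ 0`
annihilates the vector at which it is attained. -/
theorem apply_add_smul_star_apply {A : E →L[ℂ] E} (hA : ∀ u, ‖⟪u, A u⟫_ℂ‖ ≤ ‖u‖ ^ 2) {x : E}
    {a : ℂ} (ha : ‖a‖ = 1) (hx : ⟪x, A x⟫_ℂ = a * (‖x‖ : ℂ) ^ 2) :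
    conj a • A x + a • star A x = (2 : ℂ) • x := by
  set B : E →L[ℂ] E := (2 : ℂ) • 1 - (conj a • A + a • star A) with hB
  have hsa : IsSelfAdjoint B := by
    refine IsSelfAdjoint.sub ?_ ?_
    · rw [IsSelfAdjoint, star_smul, star_one]
      simp
    · rw [IsSelfAdjoint, star_add, star_smul, star_smul, star_star, add_comm]
      simp
  have hquad : ∀ u, RCLike.re ⟪u, B u⟫_ℂ = 2 * ‖u‖ ^ 2 - 2 * (conj a * ⟪u, A u⟫_ℂ).re := by
    intro u
    have h1 : ⟪u, B u⟫_ℂ = 2 * (‖u‖ : ℂ) ^ 2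
        - (conj a * ⟪u, A u⟫_ℂ + conj (conj a * ⟪u, A u⟫_ℂ)) := by
      simp only [hB, sub_apply, add_apply, smul_apply, one_apply_eq_self, inner_sub_right,
        inner_add_right, inner_smul_right, map_mul, Complex.conj_conj]
      rw [ContinuousLinearMap.star_eq_adjoint, ContinuousLinearMap.adjoint_inner_right,
        inner_conj_symm, inner_self_eq_norm_sq_to_K]
      rfl
    have h2 : 2 * (‖u‖ : ℂ) ^ 2 = ((2 * ‖u‖ ^ 2 : ℝ) : ℂ) := by push_cast; rfl
    rw [h1, Complex.add_conj, h2, ← Complex.ofReal_sub]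
    exact Complex.ofReal_re _
  have hpos : 0 ≤ B := by
    rw [ContinuousLinearMap.nonneg_iff_isPositive]
    refine ⟨ContinuousLinearMap.isSelfAdjoint_iff_isSymmetric.1 hsa, fun u => ?_⟩
    rw [ContinuousLinearMap.reApplyInnerSelf, inner_re_symm, hquad]
    have h1 : (conj a * ⟪u, A u⟫_ℂ).re ≤ ‖u‖ ^ 2 := (Complex.re_le_norm _).trans
      (by rw [norm_mul, Complex.norm_conj, ha, one_mul]; exact hA u)
    linarith
  have hsq : CFC.sqrt B * CFC.sqrt B = B := CFC.sqrt_mul_sqrt_self B hpos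
  have hsqa : star (CFC.sqrt B) = CFC.sqrt B :=
    (IsSelfAdjoint.of_nonneg (CFC.sqrt_nonneg B)).star_eq
  have h0 : ‖CFC.sqrt B x‖ ^ 2 = 0 := by
    rw [ContinuousLinearMap.apply_norm_sq_eq_inner_adjoint_right,
      ← ContinuousLinearMap.star_eq_adjoint, hsqa, ← ContinuousLinearMap.mul_def, hsq, hquad, hx,
      ← mul_assoc, Complex.conj_mul', ha]
    norm_cast
    simp
  have h1 : B x = 0 := by
    rw [← hsq, mul_apply_eq_comp, norm_eq_zero.1 (pow_eq_zero_iff two_ne_zero |>.1 h0), map_zero]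
  simp only [hB, sub_apply, add_apply, smul_apply, one_apply_eq_self] at h1
  exact (sub_eq_zero.1 h1).symm

omit [FiniteDimensional ℂ E] [CompleteSpace E] in
theorem mem_spectrum_of_apply_eq {A : E →L[ℂ] E} {x : E} (hx : x ≠ 0) {c : ℂ} (h : A x = c • x) :
    c ∈ spectrum ℂ A := by
  rw [spectrum.mem_iff]
  rintro ⟨u, hu⟩
  refine hx ?_
  have h1 := congrArg (fun B : E →L[ℂ] E => B x) u.inv_mul
  simp only [mul_apply_eq_comp, hu, sub_apply, h, Algebra.algebraMap_eq_smul_one,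
    smul_apply, one_apply_eq_self, sub_self, map_zero] at h1
  exact h1.symm

theorem exists_apply_eq_of_mem_spectrum {A : E →L[ℂ] E} {c : ℂ} (h : c ∈ spectrum ℂ A) :
    ∃ x ≠ 0, A x = c • x := by
  rw [spectrum.mem_iff, ContinuousLinearMap.isUnit_iff_bijective] at h
  by_contra! h1
  refine h ?_
  have hinj : Function.Injective (algebraMap ℂ (E →L[ℂ] E) c - A) := by
    rw [injective_iff_map_eq_zero]
    intro x hx
    by_contra hx0
    refine h1 x hx0 ?_
    rw [sub_apply, Algebra.algebraMap_eq_smul_one, smul_apply, one_apply_eq_self] at hx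
    exact (sub_eq_zero.1 hx).symm
  exact ⟨hinj, (LinearMap.injective_iff_surjective
    (f := ((algebraMap ℂ (E →L[ℂ] E) c - A : E →L[ℂ] E) : E →ₗ[ℂ] E))).1 hinj⟩

/-- The zeros of `det (A + p A* - s)` with `|p| ≤ 1` are of the form `(a + p ā, p)`, `|a| ≤ 1`. If
`|a| = 1` and `|p| < 1`, then `a` is an eigenvalue of `A`. -/
theorem exists_of_polyEval_pencilPoly {A : E →L[ℂ] E} (hA : ∀ u, ‖⟪u, A u⟫_ℂ‖ ≤ ‖u‖ ^ 2)
    {l : ℂ × ℂ} (h : polyEval (pencilPoly A) l = 0) :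
    ∃ a : ℂ, ‖a‖ ≤ 1 ∧ l.1 = a + l.2 * conj a ∧
      (‖a‖ = 1 → ‖l.2‖ < 1 → a ∈ spectrum ℂ A) := by
  obtain ⟨x, hx, hAx⟩ := exists_eigenvector_of_pencilPoly h
  obtain ⟨a, ha, hs, hxa⟩ := eq_add_mul_conj hA hx hAx
  refine ⟨a, ha, hs, fun ha1 hp => mem_spectrum_of_apply_eq hx ?_⟩
  have h1 := apply_add_smul_star_apply hA ha1 hxa
  have haa : conj a * a = 1 := by rw [Complex.conj_mul', ha1]; norm_num
  have hne : l.2 - a ^ 2 ≠ 0 := fun h0 => by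
    rw [sub_eq_zero] at h0
    rw [h0, norm_pow, ha1, one_pow] at hp
    exact lt_irrefl _ hp
  -- eliminating `A x` leaves `(p - a²) A* x = ā (p - a²) x`
  have h2 : A x + (a ^ 2) • star A x = (2 * a) • x := by
    have h3 := congrArg (fun y => a • y) h1
    simp only [smul_add, smul_smul, mul_comm a (conj a), haa, one_smul] at h3
    rw [sq, h3, mul_comm]
  have h4 : (l.2 - a ^ 2) • star A x = (l.2 - a ^ 2) • conj a • x := by
    have h5 : (l.2 - a ^ 2) • star A x = (l.1 - 2 * a) • x := by
      rw [sub_smul, sub_smul, ← hAx, ← h2]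
      abel
    rw [h5, smul_smul, hs]
    congr 1
    linear_combination a * haa
  have h5 := smul_right_injective E hne h4
  have h5' : star A x = conj a • x := h5
  rw [h5', smul_smul] at h2
  have h6 : A x = (2 * a - a ^ 2 * conj a) • x := by rw [sub_smul, ← h2, add_sub_cancel_right]
  rw [h6]
  congr 1
  linear_combination -a * haa

/-- When `A` has numerical radius at most one and spectral radius less than one, the polynomial
`s det (A + p A* - s)` is distinguished. The factor `s` provides the zero `(0, 0)` in `𝔾₂` also when
the space is trivial. -/
theorem isGammaDistinguishedPoly_pencilPoly {A : E →L[ℂ] E}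
    (hA : ∀ u, ‖⟪u, A u⟫_ℂ‖ ≤ ‖u‖ ^ 2) (hr : ∀ c ∈ spectrum ℂ A, ‖c‖ < 1) :
    IsGammaDistinguishedPoly (MvPolynomial.X 0 * pencilPoly A) := by
  rw [isGammaDistinguishedPoly_iff]
  refine ⟨⟨(0, 0), ?_, by simp⟩, fun l hl h => ?_⟩
  · simpa using add_mul_conj_mem_openSymBidisc (a := 0) (p := 0) (by simp) (by simp)
  · have hl2 := norm_snd_le_of_mem_Gamma (frontier_subset_Gamma hl)
    have hno := notMem_openSymBidisc_of_mem_frontier hl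
    obtain ⟨a, ha, hla, hsp⟩ : ∃ a : ℂ, ‖a‖ ≤ 1 ∧ l.1 = a + l.2 * conj a ∧
        (‖a‖ = 1 → ‖l.2‖ < 1 → a ∈ spectrum ℂ A) := by
      rw [polyEval_mul, mul_eq_zero] at h
      rcases h with h | h
      · exact ⟨0, by simp, by simpa using h, by simp⟩
      · exact exists_of_polyEval_pencilPoly hA h
    have hl' : l = (a + l.2 * conj a, l.2) := Prod.ext hla rfl
    rcases hl2.lt_or_eq with hp | hp
    · rcases ha.lt_or_eq with ha1 | ha1
      · exact absurd (hl' ▸ add_mul_conj_mem_openSymBidisc ha1 hp) hno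
      · exact absurd (hr a (hsp ha1 hp)) ha1.not_lt
    · rw [hl']
      exact add_mul_conj_mem_bGamma ha hp

/-- The joint spectrum of `(A + M_z A*, M_z)` lies in the zero set of `det (A + p A* - s)` and in
`|p| ≤ 1`, hence in `Γ`. -/
theorem spectrumInGamma_toeplitzOp {A : E →L[ℂ] E} (hA : ∀ u, ‖⟪u, A u⟫_ℂ‖ ≤ ‖u‖ ^ 2) :
    SpectrumInGamma (commute_toeplitzOp A) := by
  intro z hz
  by_contra hu
  obtain ⟨l, hl, hr⟩ := exists_joint_spectrum_point _ hu
  have h0 : polyEval (pencilPoly A) l = 0 := by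
    by_contra hne
    refine hr (pencilPoly A - MvPolynomial.C (polyEval (pencilPoly A) l)) (by simp) ?_
    rw [map_sub, opHom_pencilPoly, zero_sub, opHom_C, IsUnit.neg_iff,
      ← Algebra.algebraMap_eq_smul_one]
    exact (isUnit_iff_ne_zero.2 hne).map _
  have h1 : ‖l.2‖ ≤ 1 := by
    by_contra! hlt
    refine hr (MvPolynomial.C l.2 - MvPolynomial.X 1) (by simp) ?_
    rw [map_sub, opHom_C, opHom_X_one, ← Algebra.algebraMap_eq_smul_one]
    refine spectrum.mem_resolventSet_iff.1 (spectrum.mem_resolventSet_of_norm_lt_mul ?_)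
    refine lt_of_le_of_lt ?_ hlt
    refine mul_le_one₀ ?_ (norm_nonneg _) ContinuousLinearMap.norm_id_le
    exact ContinuousLinearMap.opNorm_le_bound _ zero_le_one fun x => by
      rw [norm_shiftOp_apply, one_mul]
  obtain ⟨a, ha, hs, -⟩ := exists_of_polyEval_pencilPoly hA h0
  have h2 : l ∈ Gamma := (Prod.ext hs rfl : l = (a + l.2 * conj a, l.2)) ▸
    add_mul_conj_mem_Gamma ha h1
  exact rootPoly_ne_zero hz l h2 hl

theorem isGammaContraction_toeplitzOp {A : E →L[ℂ] E} (hA : ∀ u, ‖⟪u, A u⟫_ℂ‖ ≤ ‖u‖ ^ 2) :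
    IsGammaContraction (toeplitzOp A) shiftOp :=
  isGammaContraction_of_isometry (commute_toeplitzOp A) star_shiftOp_mul (star_toeplitzOp_mul A)
    (spectrumInGamma_toeplitzOp hA)

end Determinant

/-! ### The pair `(A, 0)` -/

section Compression

variable {E : Type*} [NormedAddCommGroup E] [InnerProductSpace ℂ E]

/-- The map `(x₀, x₁, …) ↦ x₀`, with kernel the range of the shift. -/
def evalZero : Ell2 E →L[ℂ] E :=
  LinearMap.mkContinuous
    { toFun := fun x => x 0
      map_add' := fun _ _ => rfl
      map_smul' := fun _ _ => rfl } 1 fun x => by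
    rw [one_mul]
    exact lp.norm_apply_le_norm two_ne_zero x 0

theorem evalZero_apply (x : Ell2 E) : evalZero x = x 0 := rfl

theorem evalZero_firstOp (u : E) : evalZero (firstOp u) = u := by
  change lp.single (E := fun _ : ℕ => E) 2 0 u 0 = u
  simp

theorem norm_firstOp_apply (u : E) : ‖firstOp u‖ = ‖u‖ := by
  change ‖lp.single (E := fun _ : ℕ => E) 2 0 u‖ = ‖u‖
  exact lp.norm_single (E := fun _ : ℕ => E) (p := 2) (by norm_num) 0 u

variable [CompleteSpace E]

theorem evalZero_comp_opHom (A : E →L[ℂ] E) (q : MvPolynomial (Fin 2) ℂ) :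
    evalZero ∘L opHom (commute_toeplitzOp A) q
      = opHom (Commute.zero_right A) q ∘L evalZero := by
  refine opHom_intertwine (commute_toeplitzOp A) (Commute.zero_right A)
    (ContinuousLinearMap.ext fun x => ?_) (ContinuousLinearMap.ext fun x => rfl) q
  change A (x 0) + 0 = A (x 0)
  rw [add_zero]

/-- If the numerical radius of `A` is at most one, then `(A, 0)` is a `Γ`-contraction, as the
compression of `(A + M_z A*, M_z)` to the quotient by the range of `M_z`. -/
theorem isGammaContraction_zero [FiniteDimensional ℂ E] {A : E →L[ℂ] E}
    (hA : ∀ u, ‖⟪u, A u⟫_ℂ‖ ≤ ‖u‖ ^ 2) : IsGammaContraction A 0 := by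
  have hT := isGammaContraction_toeplitzOp hA
  have hG : SpectrumInGamma (Commute.zero_right A) := by
    intro z hz
    have hz0 : z ≠ 0 := norm_pos_iff.1 (one_pos.trans hz)
    have h1 : opHom (Commute.zero_right A) (rootPoly z)
        = z • (algebraMap ℂ (E →L[ℂ] E) z - A) := by
      simp only [rootPoly, map_add, map_sub, map_mul (opHom _), opHom_C, opHom_X_zero, opHom_X_one,
        Algebra.algebraMap_eq_smul_one, smul_sub, smul_smul, sq, smul_mul_assoc, one_mul, add_zero]
    rw [h1, Algebra.smul_def]
    refine ((isUnit_iff_ne_zero.2 hz0).map (algebraMap ℂ (E →L[ℂ] E))).mul ?_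
    by_contra hns
    obtain ⟨x, hx, hAx⟩ := exists_apply_eq_of_mem_spectrum (spectrum.mem_iff.2 hns)
    have h2 := hA x
    rw [hAx, inner_smul_right, inner_self_eq_norm_sq_to_K, norm_mul] at h2
    have h3 : 0 < ‖x‖ ^ 2 := pow_pos (norm_pos_iff.2 hx) 2
    simp only [norm_pow, Complex.coe_algebraMap, Complex.norm_real, norm_norm] at h2
    nlinarith
  refine ⟨Commute.zero_right A, hG.taylorSpectrum_subset, fun q hq => ?_, fun p q hq => ?_⟩
  · rw [opEval_eq (Commute.zero_right A)]
    exact hG.isUnit hq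
  · have hvN := hT.vonNeumann p q hq
    refine le_trans ?_ hvN
    have hu := hT.isUnit_opEval q hq
    have hu' := hG.isUnit hq
    rw [opEval_eq (commute_toeplitzOp A)] at hu
    rw [opEval_eq (commute_toeplitzOp A), opEval_eq (commute_toeplitzOp A),
      opEval_eq (Commute.zero_right A), opEval_eq (Commute.zero_right A)]
    set Q := opHom (commute_toeplitzOp A) q with hQ
    set Q' := opHom (Commute.zero_right A) q with hQ'
    have hinv : ∀ y, evalZero (Ring.inverse Q y) = Ring.inverse Q' (evalZero y) := fun y => by
      have h1 := congrArg (fun B : Ell2 E →L[ℂ] E => B (Ring.inverse Q y)) (evalZero_comp_opHom A q)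
      simp only [ContinuousLinearMap.comp_apply] at h1
      rw [← mul_apply_eq_comp, Ring.mul_inverse_cancel _ hu, one_apply_eq_self] at h1
      rw [h1, ← mul_apply_eq_comp, Ring.inverse_mul_cancel _ hu', one_apply_eq_self]
    refine ContinuousLinearMap.opNorm_le_bound _ (norm_nonneg _) fun u => ?_
    have h2 : (opHom (Commute.zero_right A) p * Ring.inverse Q') u
        = evalZero ((opHom (commute_toeplitzOp A) p * Ring.inverse Q) (firstOp u)) := by
      have h1 := congrArg (fun B : Ell2 E →L[ℂ] E => B (Ring.inverse Q (firstOp u)))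
        (evalZero_comp_opHom A p)
      simp only [ContinuousLinearMap.comp_apply] at h1
      rw [mul_apply_eq_comp, mul_apply_eq_comp, h1, hinv, evalZero_firstOp]
    rw [h2, ← norm_firstOp_apply u]
    exact (lp.norm_apply_le_norm two_ne_zero _ 0).trans (ContinuousLinearMap.le_opNorm _ _)

/-- An eigenvalue `c` of `A` gives the zero `(c, 0)` of an annihilating polynomial; for `|c| = 1`
it would be a boundary point outside `bΓ`. -/
theorem norm_lt_one_of_isGammaDistinguished [FiniteDimensional ℂ E] {A : E →L[ℂ] E}
    (h : IsGammaDistinguished A 0) {c : ℂ} (hc : c ∈ spectrum ℂ A) : ‖c‖ < 1 := by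
  obtain ⟨hG, q, hq, hq0⟩ := h
  obtain ⟨x, hx, hAx⟩ := exists_apply_eq_of_mem_spectrum hc
  have hmem : (c, (0 : ℂ)) ∈ Gamma := by
    refine hG.taylorSpectrum_subset fun hk => hx (hk.1 x ?_ ?_)
    · simp [hAx]
    · simp
  refine lt_of_le_of_ne (norm_le_one_of_mem_Gamma hmem) fun h1 => ?_
  have h2 : ∀ r, opHom (Commute.zero_right A) r x = polyEval r (c, 0) • x := fun r => by
    induction r using MvPolynomial.induction_on with
    | C a => simp
    | add p q hp hq => rw [map_add, add_apply, hp, hq, polyEval_add, add_smul]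
    | mul_X p n hp =>
      rw [mul_comm, map_mul, mul_apply_eq_comp, hp, map_smul, polyEval_mul, mul_comm, mul_smul]
      congr 1
      fin_cases n <;> simp [hAx, polyEval]
  have h3 : polyEval q (c, 0) = 0 := by
    have h4 := h2 q
    rw [← opEval_eq, hq0, zero_apply] at h4
    exact (smul_eq_zero.1 h4.symm).resolve_right hx
  have h5 := (isGammaDistinguishedPoly_iff.1 hq).2 _ (mem_frontier_of_norm_eq_one h1) h3
  simpa using norm_snd_of_mem_bGamma h5

end Compression

/-! ### The dilation -/

section DilationPair

variable {H : Type*} [NormedAddCommGroup H] [InnerProductSpace ℂ H]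
  {L : Type*} [NormedAddCommGroup L] [InnerProductSpace ℂ L]

omit [NormedAddCommGroup H] [InnerProductSpace ℂ H] [NormedAddCommGroup L]
  [InnerProductSpace ℂ L] in
theorem prod_ext {x y : WithLp 2 (H × L)} (h1 : x.fst = y.fst) (h2 : x.snd = y.snd) : x = y :=
  (WithLp.ofLp_injective 2) (Prod.ext h1 h2)

/-- The inclusion of the second summand of `H ⊕ L`. -/
def inclSnd : L →L[ℂ] WithLp 2 (H × L) :=
  (WithLp.prodContinuousLinearEquiv 2 ℂ H L).symm.toContinuousLinearMap ∘L
    ContinuousLinearMap.inr ℂ H L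

theorem lowerBlock_comp_inclSnd (T : H →L[ℂ] H) (C : H →L[ℂ] L) (D : L →L[ℂ] L) :
    inclSnd ∘L D = lowerBlock T C D ∘L inclSnd := by
  refine ContinuousLinearMap.ext fun y => prod_ext ?_ ?_
  · exact (map_zero T).symm
  · change D y = C 0 + D y
    rw [map_zero, zero_add]

/-- An operator on `H ⊕ L` that is block lower triangular with invertible diagonal blocks is
invertible. -/
theorem isUnit_of_triangular [CompleteSpace H] [CompleteSpace L]
    {X : WithLp 2 (H × L) →L[ℂ] WithLp 2 (H × L)}
    {Q : H →L[ℂ] H} {R : L →L[ℂ] L} (h1 : WithLp.fstL 2 ℂ H L ∘L X = Q ∘L WithLp.fstL 2 ℂ H L)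
    (h2 : inclSnd ∘L R = X ∘L inclSnd) (hQ : IsUnit Q) (hR : IsUnit R) : IsUnit X := by
  rw [ContinuousLinearMap.isUnit_iff_bijective] at *
  have h1' : ∀ x, (X x).fst = Q x.fst := fun x => congrArg (fun B => B x) h1
  have h2' : ∀ y, X (inclSnd y) = inclSnd (R y) := fun y => (congrArg (fun B => B y) h2).symm
  have hdec : ∀ x : WithLp 2 (H × L), x.fst = 0 → x = inclSnd x.snd := fun x hx => prod_ext hx rfl
  constructor
  · rw [injective_iff_map_eq_zero]
    intro x hx
    have h3 : x.fst = 0 := hQ.1 (by rw [← h1', hx, map_zero]; rfl)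
    rw [hdec x h3, h2'] at hx
    have h4 : R x.snd = 0 := congrArg WithLp.snd hx
    rw [hdec x h3, hR.1 (h4.trans (map_zero R).symm), map_zero]
  · intro z
    obtain ⟨u, hu⟩ := hQ.2 z.fst
    set w : WithLp 2 (H × L) := WithLp.toLp 2 (u, 0) with hw
    have h3 : (z - X w).fst = 0 := by
      change z.fst - (X w).fst = 0
      rw [h1', hw]
      exact sub_eq_zero.2 hu.symm
    obtain ⟨y, hy⟩ := hR.2 (z - X w).snd
    refine ⟨w + inclSnd y, ?_⟩
    rw [map_add, h2', hy, ← hdec _ h3]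
    abel

variable [CompleteSpace H] {S P : H →L[ℂ] H} {A : defectSpace P →L[ℂ] defectSpace P}

theorem fst_comp_dilationT : WithLp.fstL 2 ℂ H (Ell2 (defectSpace P)) ∘L dilationT S P A
    = S ∘L WithLp.fstL 2 ℂ H (Ell2 (defectSpace P)) := rfl

theorem fst_comp_dilationV : WithLp.fstL 2 ℂ H (Ell2 (defectSpace P)) ∘L dilationV P
    = P ∘L WithLp.fstL 2 ℂ H (Ell2 (defectSpace P)) := rfl

theorem inclSnd_comp_toeplitzOp : inclSnd ∘L toeplitzOp A = dilationT S P A ∘L inclSnd :=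
  lowerBlock_comp_inclSnd _ _ _

theorem inclSnd_comp_shiftOp :
    inclSnd ∘L shiftOp (E := defectSpace P) = dilationV P ∘L inclSnd :=
  lowerBlock_comp_inclSnd _ _ _

/-- `T_A V₀ = V₀ T_A`; the first component in `ℓ²` is the relation `D_P S = A D_P + A* D_P P`. -/
theorem commute_dilation (h : IsGammaContraction S P) [FiniteDimensional ℂ (defectSpace P)]
    (hA : IsFundamentalOperator S P A) : Commute (dilationT S P A) (dilationV P) := by
  refine ContinuousLinearMap.ext fun x => prod_ext ?_ (lp.ext (funext fun n => ?_))
  · exact congrArg (fun B : H →L[ℂ] H => B x.fst) h.commute.eq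
  · change (dilationT S P A (dilationV P x)).snd n = (dilationV P (dilationT S P A x)).snd n
    cases n with
    | zero =>
      rw [dilationT_snd_zero, dilationV_snd_zero, dilationV_snd_zero, dilationV_fst, dilationT_fst,
        hA.defectMap_comp h, add_comm]
    | succ n =>
      rw [dilationT_snd_succ, dilationV_snd_succ, dilationV_snd_succ]
      cases n with
      | zero => rw [dilationV_snd_zero, dilationT_snd_zero]
      | succ n => rw [dilationV_snd_succ, dilationT_snd_succ]

theorem inner_firstOp {E : Type*} [NormedAddCommGroup E] [InnerProductSpace ℂ E] (u : E)
    (y : Ell2 E) : ⟪firstOp u, y⟫_ℂ = ⟪u, y 0⟫_ℂ :=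
  lp.inner_single_left 0 u y

theorem star_dilationV_mul (hP : ‖P‖ ≤ 1) : star (dilationV P) * dilationV P = 1 := by
  rw [ContinuousLinearMap.star_eq_adjoint]
  refine ContinuousLinearMap.ext fun x => ext_inner_left ℂ fun y => ?_
  rw [mul_apply_eq_comp, ContinuousLinearMap.adjoint_inner_right, one_apply_eq_self,
    WithLp.prod_inner_apply, WithLp.prod_inner_apply]
  change ⟪P y.fst, P x.fst⟫_ℂ + ⟪firstOp (defectMap P y.fst) + shiftOp y.snd,
    firstOp (defectMap P x.fst) + shiftOp x.snd⟫_ℂ = ⟪y.fst, x.fst⟫_ℂ + ⟪y.snd, x.snd⟫_ℂ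
  have h1 : ⟪shiftOp y.snd, shiftOp x.snd⟫_ℂ = ⟪y.snd, x.snd⟫_ℂ := by
    rw [← ContinuousLinearMap.adjoint_inner_right, ← ContinuousLinearMap.star_eq_adjoint,
      ← mul_apply_eq_comp, star_shiftOp_mul, one_apply_eq_self]
  have h2 : ⟪shiftOp y.snd, firstOp (defectMap P x.fst)⟫_ℂ = 0 := by
    rw [← inner_conj_symm, inner_firstOp, shiftOp_apply_zero, inner_zero_right, map_zero]
  rw [inner_add_left, inner_add_right, inner_add_right, h1, h2, inner_firstOp, inner_firstOp,
    shiftOp_apply_zero, inner_zero_right, ← evalZero_apply, evalZero_firstOp, inner_defectMap hP]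
  ring

/-- `T_A = T_A* V₀`; the component in `H` is the fundamental equation. -/
theorem star_dilationT_mul (hA : IsFundamentalOperator S P A) :
    star (dilationT S P A) * dilationV P = dilationT S P A := by
  rw [ContinuousLinearMap.star_eq_adjoint]
  refine ContinuousLinearMap.ext fun x => ext_inner_left ℂ fun y => ?_
  rw [mul_apply_eq_comp, ContinuousLinearMap.adjoint_inner_right,
    WithLp.prod_inner_apply, WithLp.prod_inner_apply]
  change ⟪S y.fst, P x.fst⟫_ℂ + ⟪firstOp (star A (defectMap P y.fst)) + toeplitzOp A y.snd,
    firstOp (defectMap P x.fst) + shiftOp x.snd⟫_ℂ = ⟪y.fst, S x.fst⟫_ℂ +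
      ⟪y.snd, firstOp (star A (defectMap P x.fst)) + toeplitzOp A x.snd⟫_ℂ
  have h1 : ⟪toeplitzOp A y.snd, shiftOp x.snd⟫_ℂ = ⟪y.snd, toeplitzOp A x.snd⟫_ℂ := by
    rw [← ContinuousLinearMap.adjoint_inner_right, ← ContinuousLinearMap.star_eq_adjoint,
      ← mul_apply_eq_comp, star_toeplitzOp_mul]
  have h2 : ⟪toeplitzOp A y.snd, firstOp (defectMap P x.fst)⟫_ℂ
      = ⟪y.snd, firstOp (star A (defectMap P x.fst))⟫_ℂ := by
    rw [← inner_conj_symm, ← inner_conj_symm y.snd, inner_firstOp, inner_firstOp,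
      ContinuousLinearMap.star_eq_adjoint, ContinuousLinearMap.adjoint_inner_left]
    change starRingEnd ℂ ⟪defectMap P x.fst, A (y.snd 0) + 0⟫_ℂ = _
    rw [add_zero]
  have h3 : ⟪star A (defectMap P y.fst), defectMap P x.fst⟫_ℂ
      = ⟪y.fst, S x.fst⟫_ℂ - ⟪S y.fst, P x.fst⟫_ℂ := by
    rw [ContinuousLinearMap.star_eq_adjoint, ContinuousLinearMap.adjoint_inner_left,
      ← isFundamentalOperator_iff.1 hA, sub_apply, inner_sub_right, mul_apply_eq_comp,
      ContinuousLinearMap.star_eq_adjoint, ContinuousLinearMap.adjoint_inner_right]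
  rw [inner_add_left, inner_add_right, inner_add_right, inner_add_right, h1, h2, inner_firstOp,
    inner_firstOp, shiftOp_apply_zero, inner_zero_right, ← evalZero_apply, evalZero_firstOp, h3]
  ring

/-- The dilation `(T_A, V₀)` is a `Γ`-contraction. Its spectrum lies in `Γ` because `(T_A, V₀)` is
block triangular with diagonal `(S, P)` and `(A + M_z A*, M_z)`. -/
theorem isGammaContraction_dilation (h : IsGammaContraction S P)
    [FiniteDimensional ℂ (defectSpace P)] (hA : IsFundamentalOperator S P A) :
    IsGammaContraction (dilationT S P A) (dilationV P) := by
  refine isGammaContraction_of_isometry (commute_dilation h hA) (star_dilationV_mul h.norm_le_one)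
    (star_dilationT_mul hA) fun z hz => ?_
  exact isUnit_of_triangular
    (opHom_intertwine (commute_dilation h hA) h.commute fst_comp_dilationT fst_comp_dilationV _)
    (opHom_intertwine (commute_toeplitzOp A) (commute_dilation h hA) inclSnd_comp_toeplitzOp
      inclSnd_comp_shiftOp _)
    (h.spectrumInGamma z hz) (spectrumInGamma_toeplitzOp (hA.norm_inner_le h) z hz)

/-- A polynomial annihilating `(T_A, V₀)` annihilates `(A, 0)`. -/
theorem opEval_zero_of_opEval_dilation (h : IsGammaContraction S P)
    [FiniteDimensional ℂ (defectSpace P)] (hA : IsFundamentalOperator S P A)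
    {q : MvPolynomial (Fin 2) ℂ} (hq : opEval q (dilationT S P A) (dilationV P) = 0) :
    opEval q A 0 = 0 := by
  rw [opEval_eq (commute_dilation h hA)] at hq
  rw [opEval_eq (Commute.zero_right A)]
  have h1 := opHom_intertwine (commute_toeplitzOp A) (commute_dilation h hA)
    inclSnd_comp_toeplitzOp inclSnd_comp_shiftOp q
  rw [hq, ContinuousLinearMap.zero_comp] at h1
  have h2 : opHom (commute_toeplitzOp A) q = 0 := ContinuousLinearMap.ext fun y =>
    congrArg (fun B : Ell2 (defectSpace P) →L[ℂ] DilationSpace P => (B y).snd) h1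
  have h3 := evalZero_comp_opHom A q
  rw [h2, ContinuousLinearMap.comp_zero] at h3
  refine ContinuousLinearMap.ext fun u => ?_
  have h4 := congrArg (fun B : Ell2 (defectSpace P) →L[ℂ] defectSpace P => B (firstOp u)) h3
  rw [ContinuousLinearMap.comp_apply, evalZero_firstOp] at h4
  exact h4.symm

/-- If `q` annihilates `(S, P)` and `r` annihilates `(A + M_z A*, M_z)`, then `r q` annihilates
`(T_A, V₀)`: the range of `q(T_A, V₀)` lies in the second summand. -/
theorem opEval_dilation_mul (h : IsGammaContraction S P)
    [FiniteDimensional ℂ (defectSpace P)] (hA : IsFundamentalOperator S P A)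
    {q r : MvPolynomial (Fin 2) ℂ} (hq : opEval q S P = 0)
    (hr : opHom (commute_toeplitzOp A) r = 0) :
    opEval (r * q) (dilationT S P A) (dilationV P) = 0 := by
  rw [opEval_eq h.commute] at hq
  rw [opEval_eq (commute_dilation h hA), map_mul]
  have h1 := opHom_intertwine (commute_toeplitzOp A) (commute_dilation h hA)
    inclSnd_comp_toeplitzOp inclSnd_comp_shiftOp r
  have h2 := opHom_intertwine (commute_dilation h hA) h.commute fst_comp_dilationT
    fst_comp_dilationV q
  rw [hq, ContinuousLinearMap.zero_comp] at h2
  rw [hr, ContinuousLinearMap.comp_zero] at h1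
  refine ContinuousLinearMap.ext fun x => ?_
  set y := opHom (commute_dilation h hA) q x with hy
  have h3 : y = inclSnd y.snd := prod_ext
    (congrArg (fun B : DilationSpace P →L[ℂ] H => B x) h2) rfl
  rw [mul_apply_eq_comp, ← hy, h3]
  exact (congrArg (fun B : Ell2 (defectSpace P) →L[ℂ] DilationSpace P => B y.snd) h1).symm

end DilationPair

theorem spectralRadius_lt_one_iff {B : Type*} [NormedRing B] [NormedAlgebra ℂ B] [CompleteSpace B]
    {a : B} : spectralRadius ℂ a < 1 ↔ ∀ c ∈ spectrum ℂ a, ‖c‖ < 1 := by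
  constructor
  · intro h c hc
    have h1 : (‖c‖₊ : ℝ≥0∞) < 1 := lt_of_le_of_lt (le_iSup₂ (f := fun k _ => (‖k‖₊ : ℝ≥0∞)) c hc) h
    exact_mod_cast h1
  · intro h
    rcases (spectrum ℂ a).eq_empty_or_nonempty with h0 | h0
    · simp [spectralRadius, h0]
    · exact_mod_cast spectrum.spectralRadius_lt_of_forall_lt_of_nonempty h0 (r := 1)
        fun k hk => by exact_mod_cast h k hk

theorem spectralRadius_lt_one_of_isGammaDistinguished {E : Type*} [NormedAddCommGroup E]
    [InnerProductSpace ℂ E] [FiniteDimensional ℂ E] [CompleteSpace E] {A : E →L[ℂ] E}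
    (h : IsGammaDistinguished A 0) : spectralRadius ℂ A < 1 := by
  rw [spectralRadius_lt_one_iff]
  exact fun c hc => norm_lt_one_of_isGammaDistinguished h hc

theorem isGammaDistinguished_dilation {H : Type*} [NormedAddCommGroup H] [InnerProductSpace ℂ H]
    [CompleteSpace H] {S P : H →L[ℂ] H} (h : IsGammaDistinguished S P)
    [FiniteDimensional ℂ (defectSpace P)] {A : defectSpace P →L[ℂ] defectSpace P}
    (hA : IsFundamentalOperator S P A) (hr : spectralRadius ℂ A < 1) :
    IsGammaDistinguished (dilationT S P A) (dilationV P) := by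
  obtain ⟨hG, q, hq, hq0⟩ := h
  have hd := isGammaDistinguishedPoly_pencilPoly (hA.norm_inner_le hG)
    (spectralRadius_lt_one_iff.1 hr)
  have hr0 : opHom (commute_toeplitzOp A) (MvPolynomial.X 0 * pencilPoly A) = 0 := by
    rw [map_mul, opHom_pencilPoly, mul_zero]
  exact ⟨isGammaContraction_dilation hG hA, _, hd.mul hq, opEval_dilation_mul hG hA hq0 hr0⟩

end SymBidisc

end

theorem mainTheorem5 {H : Type*} [NormedAddCommGroup H] [InnerProductSpace ℂ H] [CompleteSpace H]
    (S P : H →L[ℂ] H) (hSP : SymBidisc.IsGammaDistinguished S P)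
    (hfin : FiniteDimensional ℂ (SymBidisc.defectSpace P)) :
    (∃! A : SymBidisc.defectSpace P →L[ℂ] SymBidisc.defectSpace P,
      SymBidisc.IsFundamentalOperator S P A) ∧
    ∀ A : SymBidisc.defectSpace P →L[ℂ] SymBidisc.defectSpace P,
      SymBidisc.IsFundamentalOperator S P A →
        List.TFAE [
          SymBidisc.IsGammaDistinguished (SymBidisc.dilationT S P A) (SymBidisc.dilationV P),
          SymBidisc.IsGammaDistinguished A 0,
          spectralRadius ℂ A < 1] := by
  obtain ⟨hG, q, hq, hq0⟩ := hSP
  constructor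
  · obtain ⟨A, hA⟩ := hG.exists_isFundamentalOperator
    exact ⟨A, hA, fun B hB => SymBidisc.IsFundamentalOperator.unique hB hA⟩
  · intro A hA
    have hw := hA.norm_inner_le hG
    tfae_have 1 → 2 := by
      rintro ⟨-, r, hr, hr0⟩
      exact ⟨SymBidisc.isGammaContraction_zero hw, r, hr,
        SymBidisc.opEval_zero_of_opEval_dilation hG hA hr0⟩
    tfae_have 2 → 3 := SymBidisc.spectralRadius_lt_one_of_isGammaDistinguished
    tfae_have 3 → 1 := fun h => SymBidisc.isGammaDistinguished_dilation ⟨hG, q, hq, hq0⟩ hA h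
    tfae_finish
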